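/- **Setting.** There are $m$ agents with identical dynamics $x_{i,t+1}=Ax_{i,t}+Bu_{i,t}+w_t$, $x_{i,1}=0$, where $x_{i,t}\in\mathbb R^{d_1}$, $u_{i,t}\in\mathbb R^{d_2}$, the matrices $A,B$ are known, and the noise $(w_t)_{t\ge 1}$ is arbitrary (adversarial) with $\|w_t\|\le W$; put $w_t=0$ for $t\le 0$. Norms of vectors are Euclidean and norms of matrices are spectral; $\|A\|,\|B\|\le\kappa$. The local costs $c_{i,t}:\mathbb R^{d_1}\times\mathbb R^{d_2}\to\mathbb R$ are arbitrary differentiable convex functions such that $\|\nabla c_{i,t}(x,u)\|\le G_cD$ whenever $\|x\|,\|u\|\le D$. The matrix $P\in\mathbb R^{m\times m}$ is symmetric and doubly stochastic, has a positive diagonal, and its graph is connected; $\beta$ is its second largest singular value ($\beta=0$ if $m=1$). A matrix $K$ is *$(\kappa,\gamma)$-strongly stable* ($\kappa>0$, $0<\gamma\le1$) if $\|K\|\le\kappa$ and $A-BK=QLQ^{-1}$ for some matrices $L,Q$ with $\|L\|\le1-\gamma$ and $\|Q\|,\|Q^{-1}\|\le\kappa$. Let $\mathcal K$ be the set of all such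 matrices, and let $K\in\mathcal K$ be known to all agents. **Algorithm.** Given $T$, $\eta$ and $H\ge1$, let $\mathcal M$ be the set of all $M=(M^{[0]},\dots,M^{[H-1]})$, $M^{[k]}\in\mathbb R^{d_2\times d_1}$, with $\|M^{[k]}\|\le2\kappa^3(1-\gamma)^k$. All agents start from the same arbitrary $M_{i,1}\in\mathcal M$. For $t=1,\dots,T$, agent $i$ applies $$u_{i,t}=-Kx_{i,t}+\sum_{k=1}^{H}M_{i,t}^{[k-1]}w_{t-k},$$ recovers $w_t=x_{i,t+1}-Ax_{i,t}-Bu_{i,t}$, and sets $$M_{i,t+1}=\Pi_{\mathcal M}\Big(\sum_{j=1}^m[P]_{ji}M_{j,t}-\eta\,\nabla f_{i,t}(M_{i,t})\Big),$$ where $\Pi_{\mathcal M}$ and $\nabla$ are the projection and the gradient for the Frobenius inner product, and $f_{i,t}(M)=c_{i,t}(y_t(M),v_t(M))$ with $$y_t(M)=\sum_{i=0}^{2H}\Psi_i(M)\,w_{t-1-i},\qquad \Psi_i(M)=(A-BK)^i\,\mathbb 1_{i\le H}+\sum_{j=0}^{H}(A-BK)^jBM^{[i-j-1]}\,\mathbb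 1_{1\le i-j\le H},$$ $$v_t(M)=-Ky_t(M)+\sum_{k=1}^HM^{[k-1]}w_{t-k}.$$ **Theorem 1.** For every $\gamma\in(0,1]$ there is $h_0>0$, depending only on $\gamma$, such that for all $m,d_1,d_2,\kappa,W,G_c$ and all $0<\eta_1\le\eta_2$, $h_0\le h_1\le h_2$ there is a constant $C$ for which the following holds, for all $T\ge2$ and for all $A,B,K,P$, noises, costs and initial parameters as above. If the algorithm is run with $\eta_1/\sqrt T\le\eta\le\eta_2/\sqrt T$ and an integer $H\ge1$ with $h_1\log T\le H\le h_2\log T$ (that is, $\eta=\Theta(1/\sqrt T)$ and $H=\Theta(\log T)$ with a sufficiently large leading constant), then $\beta<1$, the minimum of $J_T$ over $\mathcal K$ is attained, and for every agent $j$ $$\sum_{t=1}^T\sum_{i=1}^mc_{i,t}(x_{j,t},u_{j,t})-\min_{K'\in\mathcal K}J_T(K')\le C\,\frac{\sqrt T\,\log T}{(1-\beta)^2}.$$ Here $J_T(K')=\sum_{t=1}^T\sum_{i=1}^mc_{i,t}(x_t,u_t)$ is evaluated along $u_t=-K'x_t$, $x_{t+1}=Ax_t+Bu_t+w_t$, $x_1=0$.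 -/

import Mathlib

open scoped Matrix.Norms.L2Operator

noncomputable section

namespace DistControl

/-- Column vectors, with the Euclidean norm. -/
abbrev Vec (n : ℕ) := EuclideanSpace ℝ (Fin n)

/-- State-action pairs, with the Euclidean norm of the concatenated vector. -/
abbrev Pair (d₁ d₂ : ℕ) := WithLp 2 (Vec d₁ × Vec d₂)

/-- The state-action pair `(x, u)`. -/
def pair {d₁ d₂ : ℕ} (x : Vec d₁) (u : Vec d₂) : Pair d₁ d₂ := WithLp.toLp 2 (x, u)

/-- Matrix-vector product on Euclidean vectors.  The norm `‖A‖` of a matrix is the spectral norm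
(the operator norm for Euclidean vectors) throughout. -/
def app {m n : ℕ} (A : Matrix (Fin m) (Fin n) ℝ) (x : Vec n) : Vec m := Matrix.toEuclideanLin A x

/-- `K` is a `(κ, γ)`-strongly stable linear policy (`u = -K x`) for the system `(A, B)`. -/
def StronglyStable {d₁ d₂ : ℕ} (κ γ : ℝ) (A : Matrix (Fin d₁) (Fin d₁) ℝ)
    (B : Matrix (Fin d₁) (Fin d₂) ℝ) (K : Matrix (Fin d₂) (Fin d₁) ℝ) : Prop :=
  0 < κ ∧ 0 < γ ∧ γ ≤ 1 ∧ ‖K‖ ≤ κ ∧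
    ∃ L Q : Matrix (Fin d₁) (Fin d₁) ℝ, IsUnit Q ∧ A - B * K = Q * L * Q⁻¹ ∧
      ‖L‖ ≤ 1 - γ ∧ ‖Q‖ ≤ κ ∧ ‖Q⁻¹‖ ≤ κ

/-! ### Network -/

/-- `P` is a symmetric doubly stochastic matrix with positive diagonal whose graph (distinct agents
`i`, `j` are neighbours when the weight `P i j` is positive) is connected. -/
structure IsNetwork {m : ℕ} (P : Matrix (Fin m) (Fin m) ℝ) : Prop where
  symm : P.IsSymm
  doublyStochastic : P ∈ doublyStochastic ℝ (Fin m)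
  diag_pos : ∀ i, 0 < P i i
  connected : (SimpleGraph.fromRel fun i j => 0 < P i j).Connected

/-- The second largest singular value of `P` (singular values are counted with multiplicity and
indexed from `0`; the value is `0` for a single agent). -/
def secondSingularValue {m : ℕ} (P : Matrix (Fin m) (Fin m) ℝ) : ℝ :=
  (Matrix.toEuclideanLin P).singularValues 1

/-! ### Disturbance feedback controllers -/

/-- Parameters `M = (M^[0], …, M^[H-1])`, each `M^[k]` a `d₂ × d₁` matrix, as a Euclidean space: its
norm is the Frobenius norm. -/
abbrev Param (H d₁ d₂ : ℕ) := EuclideanSpace ℝ (Fin H × Fin d₂ × Fin d₁)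

/-- The block `M^[k]`; it is read as zero for `k ≥ H`. -/
def block {H d₁ d₂ : ℕ} (M : Param H d₁ d₂) (k : ℕ) : Matrix (Fin d₂) (Fin d₁) ℝ :=
  Matrix.of fun a b => if h : k < H then M (⟨k, h⟩, a, b) else 0

/-- The feasible set: `‖M^[k]‖ ≤ 2 κ³ (1 - γ)^k` for `k = 0, …, H-1`. -/
def feasible (H d₁ d₂ : ℕ) (κ γ : ℝ) : Set (Param H d₁ d₂) :=
  {M | ∀ k < H, ‖block M k‖ ≤ 2 * κ ^ 3 * (1 - γ) ^ k}

/-- `N` is the Euclidean projection of `M` to the set `S`. -/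
def IsProjection {E : Type*} [NormedAddCommGroup E] (S : Set E) (M N : E) : Prop :=
  N ∈ S ∧ ∀ N' ∈ S, ‖M - N‖ ≤ ‖M - N'‖

/-- The past noise `w_{t-k}`, where times start at `1` and `w_s = 0` for `s ≤ 0`. -/
def past {n : ℕ} (w : ℕ → Vec n) (t k : ℕ) : Vec n := if k < t then w (t - k) else 0

/-- Second summand of the control of a disturbance feedback controller at time `t`:
`∑_{k=1}^{H} M^[k-1] w_{t-k}`. -/
def feedforward {H d₁ d₂ : ℕ} (M : Param H d₁ d₂) (w : ℕ → Vec d₁) (t : ℕ) : Vec d₂ :=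
  ∑ k ∈ Finset.Icc 1 H, app (block M (k - 1)) (past w t k)

/-- Disturbance-state transfer matrix `Ψ^{K,h}_i(M)` of a time-invariant parameter `M`. -/
def transfer {H d₁ d₂ : ℕ} (A : Matrix (Fin d₁) (Fin d₁) ℝ) (B : Matrix (Fin d₁) (Fin d₂) ℝ)
    (K : Matrix (Fin d₂) (Fin d₁) ℝ) (h : ℕ) (M : Param H d₁ d₂) (i : ℕ) :
    Matrix (Fin d₁) (Fin d₁) ℝ :=
  (if i ≤ h then (A - B * K) ^ i else 0) +
    ∑ j ∈ Finset.range (h + 1),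
      if j + 1 ≤ i ∧ i ≤ j + H then (A - B * K) ^ j * B * block M (i - j - 1) else 0

/-- Surrogate state `y_t(M) = ∑_{i=0}^{2H} Ψ^{K,H}_i(M) w_{t-1-i}`. -/
def surrogateState {H d₁ d₂ : ℕ} (A : Matrix (Fin d₁) (Fin d₁) ℝ)
    (B : Matrix (Fin d₁) (Fin d₂) ℝ) (K : Matrix (Fin d₂) (Fin d₁) ℝ) (w : ℕ → Vec d₁) (t : ℕ)
    (M : Param H d₁ d₂) : Vec d₁ :=
  ∑ i ∈ Finset.range (2 * H + 1), app (transfer A B K H M i) (past w t (i + 1))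

/-- Surrogate action `v_t(M) = -K y_t(M) + ∑_{k=1}^{H} M^[k-1] w_{t-k}`. -/
def surrogateAction {H d₁ d₂ : ℕ} (A : Matrix (Fin d₁) (Fin d₁) ℝ)
    (B : Matrix (Fin d₁) (Fin d₂) ℝ) (K : Matrix (Fin d₂) (Fin d₁) ℝ) (w : ℕ → Vec d₁) (t : ℕ)
    (M : Param H d₁ d₂) : Vec d₂ :=
  -app K (surrogateState A B K w t M) + feedforward M w t

/-- Surrogate cost `f_t(M) = c_t(y_t(M), v_t(M))`, for the cost function `ct = c_t`. -/
def surrogateCost {H d₁ d₂ : ℕ} (A : Matrix (Fin d₁) (Fin d₁) ℝ) (B : Matrix (Fin d₁) (Fin d₂) ℝ)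
    (K : Matrix (Fin d₂) (Fin d₁) ℝ) (w : ℕ → Vec d₁) (ct : Pair d₁ d₂ → ℝ) (t : ℕ)
    (M : Param H d₁ d₂) : ℝ :=
  ct (pair (surrogateState A B K w t M) (surrogateAction A B K w t M))

/-! ### The distributed algorithm -/

/-- A run over the rounds `1, …, T` of the distributed disturbance feedback controller for a known
system on the noise sequence `w` and the local costs `c i t`.  Agent `i` has state `x i t`, control
`u i t`, recovered noise `what i t` and parameter `M i t` at time `t`. -/
structure IsRun {m H d₁ d₂ : ℕ} (κ γ η : ℝ) (A : Matrix (Fin d₁) (Fin d₁) ℝ)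
    (B : Matrix (Fin d₁) (Fin d₂) ℝ) (K : Matrix (Fin d₂) (Fin d₁) ℝ)
    (P : Matrix (Fin m) (Fin m) ℝ) (T : ℕ) (w : ℕ → Vec d₁) (c : Fin m → ℕ → Pair d₁ d₂ → ℝ)
    (x : Fin m → ℕ → Vec d₁) (u : Fin m → ℕ → Vec d₂) (what : Fin m → ℕ → Vec d₁)
    (M : Fin m → ℕ → Param H d₁ d₂) : Prop where
  /-- all agents start in the zero state -/
  state_init : ∀ i, x i 1 = 0
  /-- the same arbitrary feasible initial parameter for all agents -/
  param_init : ∃ M₁ ∈ feasible H d₁ d₂ κ γ, ∀ i, M i 1 = M₁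
  control : ∀ i, ∀ t ∈ Finset.Icc 1 T, u i t = -app K (x i t) + feedforward (M i t) (what i) t
  dynamics : ∀ i, ∀ t ∈ Finset.Icc 1 T, x i (t + 1) = app A (x i t) + app B (u i t) + w t
  /-- the agent recovers the noise from the observed transition -/
  recover : ∀ i, ∀ t ∈ Finset.Icc 1 T, what i t = x i (t + 1) - app A (x i t) - app B (u i t)
  /-- communication, local gradient step and projection to the feasible set -/
  update : ∀ i, ∀ t ∈ Finset.Icc 1 T, IsProjection (feasible H d₁ d₂ κ γ)
    ((∑ j, P j i • M j t) - η • gradient (surrogateCost A B K (what i) (c i t) t) (M i t))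
    (M i (t + 1))

/-! ### Costs, benchmark -/

/-- A convex differentiable cost function with `‖∇c(x, u)‖ ≤ G D` whenever `‖x‖, ‖u‖ ≤ D`. -/
structure IsCost {d₁ d₂ : ℕ} (G : ℝ) (c : Pair d₁ d₂ → ℝ) : Prop where
  convex : ConvexOn ℝ Set.univ c
  differentiable : Differentiable ℝ c
  gradient_le : ∀ (D : ℝ) (x : Vec d₁) (u : Vec d₂), ‖x‖ ≤ D → ‖u‖ ≤ D →
    ‖gradient c (pair x u)‖ ≤ G * D

/-- Accumulated network cost `∑_{t=1}^{T} ∑_i c_{i,t}(x_t, u_t)` of a state-action sequence. -/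
def totalCost {m d₁ d₂ : ℕ} (c : Fin m → ℕ → Pair d₁ d₂ → ℝ) (T : ℕ) (x : ℕ → Vec d₁)
    (u : ℕ → Vec d₂) : ℝ :=
  ∑ t ∈ Finset.Icc 1 T, ∑ i, c i t (pair (x t) (u t))

/-- State at time `t ≥ 1` under the linear policy `u = -K x`, from the zero state at time `1`
(the value at time `0` is not used). -/
def linearState {d₁ d₂ : ℕ} (A : Matrix (Fin d₁) (Fin d₁) ℝ) (B : Matrix (Fin d₁) (Fin d₂) ℝ)
    (w : ℕ → Vec d₁) (K : Matrix (Fin d₂) (Fin d₁) ℝ) : ℕ → Vec d₁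
  | 0 => 0
  | 1 => 0
  | t + 2 => app A (linearState A B w K (t + 1)) + app B (-app K (linearState A B w K (t + 1))) +
      w (t + 1)

/-- `J_T(K)`: the accumulated network cost of the linear policy `u = -K x`. -/
def linearCost {m d₁ d₂ : ℕ} (A : Matrix (Fin d₁) (Fin d₁) ℝ) (B : Matrix (Fin d₁) (Fin d₂) ℝ)
    (w : ℕ → Vec d₁) (c : Fin m → ℕ → Pair d₁ d₂ → ℝ) (T : ℕ) (K : Matrix (Fin d₂) (Fin d₁) ℝ) :
    ℝ :=
  totalCost c T (linearState A B w K) fun t => -app K (linearState A B w K t)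

end DistControl

end

/-!
Under disturbance feedback with a fixed parameter the closed loop forgets the past at the rate
`(1 - γ) ^ t`, so the truncated surrogate costs `f_{i,t}` differ from the true ones by
`O((1 - γ) ^ H)`. They are convex, because the truncated state-action pair is affine in the
parameter, and their gradients are `O(√H)`, because `∑ k, ‖M^{[k]}‖ ≤ √H * ‖M‖`.

On these costs the agents run projected gradient descent over a network. The mixing matrix contracts
their disagreement by `β` in every round, so it stays `O(η * √H / (1 - β))`, and telescoping the
squared distance to a competitor bounds the regret by the squared diameter of the feasible set over
`η`, plus `O(T * η * H / (1 - β))`.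

Two comparisons bring this back to the control problem. Parameters that move by
`O(η * √H / (1 - β))` per round keep the true state within `O(η * H / (1 - β))` of the surrogate
state, and a strongly stable `K'` is imitated, up to truncation, by the feasible parameter
`M^{[k]} = (K - K') * (A - B * K') ^ k`. Finally `log T / γ ≤ H` makes `T * (1 - γ) ^ H` at most
`1`, and `η` of order `1 / √T` balances `H / η` against `T * η * H`.
-/

namespace DistControl

/-! ### Convexity -/

theorem sub_le_fderiv_of_convexOn {E : Type*} [NormedAddCommGroup E] [NormedSpace ℝ E] {f : E → ℝ}
    {p : E} (hf : ConvexOn ℝ Set.univ f) (hp : DifferentiableAt ℝ f p) (q : E) :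
    f p - f q ≤ fderiv ℝ f p (p - q) := by
  have hline : HasDerivAt (AffineMap.lineMap p q) (q - p) (0 : ℝ) := AffineMap.hasDerivAt_lineMap
  have hp' : HasFDerivAt f (fderiv ℝ f p) (AffineMap.lineMap p q (0 : ℝ)) := by
    simpa using hp.hasFDerivAt
  have hslope := (hf.comp_affineMap (AffineMap.lineMap (k := ℝ) p q)).le_slope_of_hasDerivAt
    (Set.mem_univ 0) (Set.mem_univ 1) one_pos (hp'.comp_hasDerivAt (0 : ℝ) hline)
  simp only [slope_def_field, Function.comp_apply, AffineMap.lineMap_apply_zero,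
    AffineMap.lineMap_apply_one, sub_zero, div_one, map_sub] at hslope
  rw [map_sub]
  linarith

theorem IsProjection.norm_sub_le {E : Type*} [NormedAddCommGroup E] [InnerProductSpace ℝ E]
    {S : Set E} {a b z : E} (hS : Convex ℝ S) (hb : IsProjection S a b) (hz : z ∈ S) :
    ‖b - z‖ ≤ ‖a - z‖ := by
  have hinf : ‖a - b‖ = ⨅ v : S, ‖a - v‖ := by
    have : Nonempty S := ⟨⟨b, hb.1⟩⟩
    refine le_antisymm (le_ciInf fun v => hb.2 v v.2) ?_
    exact ciInf_le (f := fun v : S => ‖a - v‖) ⟨0, by rintro _ ⟨v, rfl⟩; positivity⟩ ⟨b, hb.1⟩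
  have hobtuse := (norm_eq_iInf_iff_real_inner_le_zero hS hb.1).1 hinf z hz
  have hsq : ‖a - z‖ ^ 2 = ‖a - b‖ ^ 2 - 2 * inner ℝ (a - b) (z - b) + ‖z - b‖ ^ 2 := by
    rw [← norm_sub_sq_real, sub_sub_sub_cancel_right]
  rw [norm_sub_rev b z]
  refine le_of_sq_le_sq ?_ (norm_nonneg _)
  linarith [sq_nonneg ‖a - b‖]

/-! ### Singular values -/

section SingularValues

variable {E F : Type*} [NormedAddCommGroup E] [InnerProductSpace ℝ E] [FiniteDimensional ℝ E]
  [NormedAddCommGroup F] [InnerProductSpace ℝ F] [FiniteDimensional ℝ F] {T : E →ₗ[ℝ] F}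

theorem exists_orthonormalBasis_inner_map (T : E →ₗ[ℝ] F) {n : ℕ}
    (hn : Module.finrank ℝ E = n) :
    ∃ b : OrthonormalBasis (Fin n) ℝ E, ∀ k v,
      inner ℝ (T (b k)) (T v) = T.singularValues k ^ 2 * inner ℝ (b k) v := by
  have hsymm := T.isSymmetric_adjoint_comp_self
  refine ⟨hsymm.eigenvectorBasis hn, fun k v => ?_⟩
  rw [← LinearMap.adjoint_inner_left, ← LinearMap.comp_apply, hsymm.apply_eigenvectorBasis,
    inner_smul_left, T.sq_singularValues_fin hn]
  rfl

theorem norm_sq_map_eq_sum {n : ℕ} {b : OrthonormalBasis (Fin n) ℝ E}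
    (hb : ∀ k v, inner ℝ (T (b k)) (T v) = T.singularValues k ^ 2 * inner ℝ (b k) v) (v : E) :
    ‖T v‖ ^ 2 = ∑ k : Fin n, T.singularValues k ^ 2 * inner ℝ (b k) v ^ 2 := by
  calc ‖T v‖ ^ 2 = inner ℝ (T (∑ k, inner ℝ (b k) v • b k)) (T v) := by
        rw [b.sum_repr', real_inner_self_eq_norm_sq]
    _ = ∑ k : Fin n, T.singularValues k ^ 2 * inner ℝ (b k) v ^ 2 := by
        simp only [map_sum, map_smul, sum_inner, real_inner_smul_left, hb]
        exact Finset.sum_congr rfl fun k _ => by ring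

theorem singularValues_one_lt_one {e : E} (h : ∀ v, ‖v‖ ≤ ‖T v‖ → ∃ a : ℝ, v = a • e) :
    T.singularValues 1 < 1 := by
  by_contra! hge
  have hdim : 1 < Module.finrank ℝ E := by
    by_contra! hle
    rw [T.singularValues_of_finrank_le hle] at hge
    exact absurd hge (by norm_num)
  obtain ⟨b, hb⟩ := exists_orthonormalBasis_inner_map T rfl
  have hexpand : ∀ k : Fin _, (k : ℕ) ≤ 1 → ‖b k‖ ≤ ‖T (b k)‖ := fun k hk => by
    have hk1 : 1 ≤ T.singularValues k := hge.trans (T.singularValues_antitone hk)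
    have hsq := hb k (b k)
    rw [real_inner_self_eq_norm_sq, real_inner_self_eq_norm_sq, b.norm_eq_one] at hsq
    rw [b.norm_eq_one]
    nlinarith [norm_nonneg (T (b k))]
  obtain ⟨a₀, h₀⟩ := h _ (hexpand ⟨0, by omega⟩ zero_le_one)
  obtain ⟨a₁, h₁⟩ := h _ (hexpand ⟨1, hdim⟩ le_rfl)
  have horth : inner ℝ (b ⟨0, by omega⟩) (b ⟨1, hdim⟩) = 0 := b.orthonormal.2 (by simp)
  have hne₀ := b.orthonormal.ne_zero ⟨0, by omega⟩
  have hne₁ := b.orthonormal.ne_zero ⟨1, hdim⟩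
  rw [h₀, smul_ne_zero_iff] at hne₀
  rw [h₁, smul_ne_zero_iff] at hne₁
  rw [h₀, h₁, real_inner_smul_left, real_inner_smul_right] at horth
  simp [hne₀.1, hne₀.2, hne₁.1] at horth

theorem norm_map_le_of_inner_eq_zero {e v : E} (he : ∀ u, inner ℝ (T e) (T u) = inner ℝ e u)
    (he₀ : e ≠ 0) (hT : T.singularValues 1 < 1) (hv : inner ℝ e v = 0) :
    ‖T v‖ ≤ T.singularValues 1 * ‖v‖ := by
  obtain ⟨b, hb⟩ := exists_orthonormalBasis_inner_map T rfl
  have hσ : ∀ k : ℕ, k ≠ 0 → T.singularValues k ^ 2 ≤ T.singularValues 1 ^ 2 :=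
    fun k hk => pow_le_pow_left₀ (T.singularValues_nonneg k)
      (T.singularValues_antitone (Nat.one_le_iff_ne_zero.2 hk)) 2
  have hbe : ∀ k : Fin _, (k : ℕ) ≠ 0 → inner ℝ (b k) e = 0 := fun k hk => by
    have hfix := hb k e
    rw [real_inner_comm, he, real_inner_comm] at hfix
    have hlt : T.singularValues k ^ 2 < 1 :=
      (hσ k hk).trans_lt (pow_lt_one₀ (T.singularValues_nonneg 1) hT two_ne_zero)
    exact (mul_eq_zero.1 (by linarith : (1 - T.singularValues k ^ 2) * inner ℝ (b k) e = 0)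
      ).resolve_left (by linarith)
  have hbv : ∀ k : Fin _, (k : ℕ) = 0 → inner ℝ (b k) v = 0 := fun k hk => by
    have hother : ∀ i ≠ k, inner ℝ (b i) e = 0 := fun i hi =>
      hbe i fun h => hi (Fin.ext (h.trans hk.symm))
    have hsum := b.sum_inner_mul_inner e v
    rw [hv, Finset.sum_eq_single k (fun i _ hi => by rw [real_inner_comm, hother i hi, zero_mul])
      (by simp)] at hsum
    refine (mul_eq_zero.1 hsum).resolve_left fun h => he₀ ?_
    rw [← b.sum_repr' e, Finset.sum_eq_single k (fun i _ hi => by rw [hother i hi, zero_smul])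
      (by simp), real_inner_comm, h, zero_smul]
  refine le_of_sq_le_sq ?_ (mul_nonneg (T.singularValues_nonneg 1) (norm_nonneg v))
  rw [mul_pow, norm_sq_map_eq_sum hb, ← b.sum_sq_inner_right, Finset.mul_sum]
  refine Finset.sum_le_sum fun k _ => ?_
  by_cases hk : (k : ℕ) = 0
  · simp [hbv k hk]
  · exact mul_le_mul_of_nonneg_right (hσ k hk) (sq_nonneg _)

end SingularValues

/-! ### Mixing -/

section DoublyStochastic

open Matrix

variable {n : Type*} [Fintype n]

theorem inner_one_left (v : EuclideanSpace ℝ n) : inner ℝ (WithLp.toLp 2 1) v = ∑ i, v i := by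
  simp [PiLp.inner_apply]

variable [DecidableEq n] {P : Matrix n n ℝ}

theorem toEuclideanLin_apply_eq_sum (P : Matrix n n ℝ) (v : EuclideanSpace ℝ n) (i : n) :
    toEuclideanLin P v i = ∑ j, P i j * v j :=
  rfl

theorem norm_sq_sub_norm_sq_toEuclideanLin (hP : P ∈ doublyStochastic ℝ n)
    (v : EuclideanSpace ℝ n) :
    ‖v‖ ^ 2 - ‖toEuclideanLin P v‖ ^ 2 =
      ∑ i, ∑ j, P i j * (v j - toEuclideanLin P v i) ^ 2 := by
  have hrow : ∀ i, ∑ j, P i j * (v j - toEuclideanLin P v i) ^ 2 =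
      ∑ j, P i j * v j ^ 2 - toEuclideanLin P v i ^ 2 := fun i => by
    set a := toEuclideanLin P v i with ha
    calc ∑ j, P i j * (v j - a) ^ 2
        = ∑ j, P i j * v j ^ 2 - 2 * a * ∑ j, P i j * v j + a ^ 2 * ∑ j, P i j := by
          simp only [Finset.mul_sum, ← Finset.sum_sub_distrib, ← Finset.sum_add_distrib]
          exact Finset.sum_congr rfl fun j _ => by ring
      _ = ∑ j, P i j * v j ^ 2 - a ^ 2 := by
          rw [← toEuclideanLin_apply_eq_sum, ← ha, sum_row_of_mem_doublyStochastic hP]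
          ring
  simp only [hrow, Finset.sum_sub_distrib, EuclideanSpace.real_norm_sq_eq]
  rw [Finset.sum_comm]
  simp only [← Finset.sum_mul, sum_col_of_mem_doublyStochastic hP, one_mul]

theorem sum_toEuclideanLin_apply (hP : P ∈ doublyStochastic ℝ n) (v : EuclideanSpace ℝ n) :
    ∑ i, toEuclideanLin P v i = ∑ i, v i :=
  sum_mulVec_of_mem_doublyStochastic hP

theorem toEuclideanLin_one (hP : P ∈ doublyStochastic ℝ n) :
    toEuclideanLin P (WithLp.toLp 2 1) = WithLp.toLp 2 1 :=
  congrArg (WithLp.toLp 2) (mulVec_one_of_mem_doublyStochastic hP)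

end DoublyStochastic

section Network

open Matrix

variable {m : ℕ} {P : Matrix (Fin m) (Fin m) ℝ}

theorem secondSingularValue_nonneg (P : Matrix (Fin m) (Fin m) ℝ) : 0 ≤ secondSingularValue P :=
  LinearMap.singularValues_nonneg _ _

theorem IsNetwork.apply_eq_of_norm_le (hP : IsNetwork P) {v : EuclideanSpace ℝ (Fin m)}
    (hv : ‖v‖ ≤ ‖toEuclideanLin P v‖) (i j : Fin m) : v i = v j := by
  have hnonneg : ∀ i j, 0 ≤ P i j * (v j - toEuclideanLin P v i) ^ 2 := fun i j =>
    mul_nonneg (nonneg_of_mem_doublyStochastic hP.doublyStochastic) (sq_nonneg _)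
  have hsum : ∑ i, ∑ j, P i j * (v j - toEuclideanLin P v i) ^ 2 = 0 := by
    refine le_antisymm ?_ (Finset.sum_nonneg fun i _ => Finset.sum_nonneg fun j _ => hnonneg i j)
    rw [← norm_sq_sub_norm_sq_toEuclideanLin hP.doublyStochastic]
    exact sub_nonpos.2 (pow_le_pow_left₀ (norm_nonneg v) hv 2)
  have hmean : ∀ i j, 0 < P i j → v j = toEuclideanLin P v i := fun i j hij => by
    have hrow := (Finset.sum_eq_zero_iff_of_nonneg fun i _ =>
      Finset.sum_nonneg fun j _ => hnonneg i j).1 hsum i (Finset.mem_univ i)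
    have hterm := (Finset.sum_eq_zero_iff_of_nonneg fun j _ => hnonneg i j).1 hrow j
      (Finset.mem_univ j)
    simpa [hij.ne', sub_eq_zero] using hterm
  have hadj : ∀ a b, (SimpleGraph.fromRel fun i j => 0 < P i j).Adj a b → v a = v b := by
    intro a b hab
    rcases ((SimpleGraph.fromRel_adj _ _ _).1 hab).2 with h | h
    · rw [hmean a b h, hmean a a (hP.diag_pos a)]
    · rw [hmean b a h, hmean b b (hP.diag_pos b)]
  obtain ⟨walk⟩ := hP.connected.preconnected i j
  induction walk with
  | nil => rfl
  | cons h _ ih => exact (hadj _ _ h).trans ih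

theorem IsNetwork.secondSingularValue_lt_one (hP : IsNetwork P) : secondSingularValue P < 1 := by
  obtain ⟨i₀⟩ := hP.connected.nonempty
  refine singularValues_one_lt_one (e := WithLp.toLp 2 1) fun v hv => ⟨v i₀, ?_⟩
  ext i
  simpa using hP.apply_eq_of_norm_le hv i i₀

theorem IsNetwork.norm_toEuclideanLin_le (hP : IsNetwork P) {v : EuclideanSpace ℝ (Fin m)}
    (hv : ∑ i, v i = 0) : ‖toEuclideanLin P v‖ ≤ secondSingularValue P * ‖v‖ := by
  obtain ⟨i₀⟩ := hP.connected.nonempty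
  refine norm_map_le_of_inner_eq_zero (e := WithLp.toLp 2 1) (fun u => ?_) (fun h => ?_)
    hP.secondSingularValue_lt_one ((inner_one_left v).trans hv)
  · rw [toEuclideanLin_one hP.doublyStochastic, inner_one_left, inner_one_left,
      sum_toEuclideanLin_apply hP.doublyStochastic]
  · simpa using congrArg (fun y : EuclideanSpace ℝ (Fin m) => y i₀) h

theorem IsNetwork.sum_norm_sq_mix_le {E : Type*} [NormedAddCommGroup E] [InnerProductSpace ℝ E]
    [FiniteDimensional ℝ E] (hP : IsNetwork P) {z : Fin m → E} (hz : ∑ i, z i = 0) :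
    ∑ i, ‖∑ j, P j i • z j‖ ^ 2 ≤ secondSingularValue P ^ 2 * ∑ i, ‖z i‖ ^ 2 := by
  set b := stdOrthonormalBasis ℝ E
  simp only [← b.sum_sq_inner_right]
  rw [Finset.sum_comm, Finset.sum_comm (f := fun i k => inner ℝ (b k) (z i) ^ 2), Finset.mul_sum]
  refine Finset.sum_le_sum fun k _ => ?_
  have hmix := hP.norm_toEuclideanLin_le (v := WithLp.toLp 2 fun i => inner ℝ (b k) (z i)) (by
    simp only [← inner_sum, hz, inner_zero_right])
  replace hmix := pow_le_pow_left₀ (norm_nonneg _) hmix 2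
  simpa only [mul_pow, EuclideanSpace.real_norm_sq_eq, toEuclideanLin_apply_eq_sum, inner_sum,
    real_inner_smul_right, hP.symm.apply] using hmix

end Network

/-! ### Projected gradient descent over a network -/

section Average

variable {ι E : Type*} [Fintype ι] [NormedAddCommGroup E] [InnerProductSpace ℝ E]

/-- The mean of a finite family of vectors. -/
noncomputable def average (z : ι → E) : E :=
  (Fintype.card ι : ℝ)⁻¹ • ∑ i, z i

/-- The disagreement of a finite family of vectors: the Euclidean norm of the family of the
differences to the average. -/
noncomputable def deviation (z : ι → E) : ℝ :=
  ‖(WithLp.toLp 2 fun i => z i - average z : PiLp 2 fun _ : ι => E)‖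

theorem deviation_sq (z : ι → E) : deviation z ^ 2 = ∑ i, ‖z i - average z‖ ^ 2 :=
  PiLp.norm_sq_eq_of_L2 _ _

theorem deviation_nonneg (z : ι → E) : 0 ≤ deviation z :=
  norm_nonneg _

theorem norm_sub_le_deviation (z : ι → E) (i j : ι) : ‖z i - z j‖ ≤ 2 * deviation z := by
  have hcoord : ∀ k, ‖z k - average z‖ ≤ deviation z :=
    PiLp.norm_apply_le (WithLp.toLp 2 fun i => z i - average z : PiLp 2 fun _ : ι => E)
  rw [← sub_sub_sub_cancel_right (z i) (z j) (average z)]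
  linarith [norm_sub_le (z i - average z) (z j - average z), hcoord i, hcoord j]

theorem deviation_add_le (z e : ι → E) :
    deviation (fun i => z i + e i) ≤ deviation z + deviation e := by
  have hsplit : (WithLp.toLp 2 fun i => z i + e i - average fun i => z i + e i :
      PiLp 2 fun _ : ι => E) =
      (WithLp.toLp 2 fun i => z i - average z) + WithLp.toLp 2 fun i => e i - average e := by
    ext i
    simp only [average, Finset.sum_add_distrib, smul_add, PiLp.add_apply]
    abel
  rw [deviation, hsplit]
  exact norm_add_le _ _

variable [Nonempty ι]

theorem card_smul_average (z : ι → E) : (Fintype.card ι : ℝ) • average z = ∑ i, z i := by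
  rw [average, smul_inv_smul₀ (by simp)]

theorem sum_sub_average (z : ι → E) : ∑ i, (z i - average z) = 0 := by
  rw [Finset.sum_sub_distrib, Finset.sum_const, Finset.card_univ, ← Nat.cast_smul_eq_nsmul ℝ,
    card_smul_average, sub_self]

theorem deviation_const (a : E) : deviation (fun _ : ι => a) = 0 := by
  have havg : average (fun _ : ι => a) = a := by
    simp [average, ← Nat.cast_smul_eq_nsmul ℝ]
  rw [← sq_eq_zero_iff, deviation_sq, havg]
  simp

theorem deviation_sq_le (z : ι → E) : deviation z ^ 2 ≤ ∑ i, ‖z i‖ ^ 2 := by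
  have hpyth : ∑ i, ‖z i‖ ^ 2 = deviation z ^ 2 + Fintype.card ι * ‖average z‖ ^ 2 := by
    have hterm : ∀ i, ‖z i‖ ^ 2 =
        ‖z i - average z‖ ^ 2 + 2 * inner ℝ (z i - average z) (average z) + ‖average z‖ ^ 2 :=
      fun i => by rw [← norm_add_sq_real, sub_add_cancel]
    simp only [hterm, Finset.sum_add_distrib, ← Finset.mul_sum, ← sum_inner, sum_sub_average,
      inner_zero_left, deviation_sq, Finset.sum_const, Finset.card_univ, nsmul_eq_mul]
    ring
  rw [hpyth]
  exact le_add_of_nonneg_right (by positivity)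

theorem deviation_le_of_forall_norm_le {z : ι → E} {ε : ℝ} (hz : ∀ i, ‖z i‖ ≤ ε) :
    deviation z ≤ √(Fintype.card ι) * ε := by
  obtain ⟨i₀⟩ := ‹Nonempty ι›
  have hε : 0 ≤ ε := (norm_nonneg _).trans (hz i₀)
  refine le_of_sq_le_sq ?_ (by positivity)
  calc deviation z ^ 2 ≤ ∑ i, ‖z i‖ ^ 2 := deviation_sq_le z
    _ ≤ ∑ _i : ι, ε ^ 2 := Finset.sum_le_sum fun i _ => pow_le_pow_left₀ (norm_nonneg _) (hz i) 2
    _ = (√(Fintype.card ι) * ε) ^ 2 := by simp [mul_pow]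

end Average

section Mix

variable {n : Type*} [Fintype n] [DecidableEq n] {P : Matrix n n ℝ}

theorem sum_mix {E : Type*} [AddCommGroup E] [Module ℝ E] (hP : P ∈ doublyStochastic ℝ n)
    (z : n → E) : ∑ i, ∑ j, P j i • z j = ∑ j, z j := by
  rw [Finset.sum_comm]
  simp only [← Finset.sum_smul, sum_row_of_mem_doublyStochastic hP, one_smul]

theorem mix_sub {E : Type*} [AddCommGroup E] [Module ℝ E] (hP : P ∈ doublyStochastic ℝ n)
    (z : n → E) (a : E) (i : n) : ∑ j, P j i • z j - a = ∑ j, P j i • (z j - a) := by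
  simp only [smul_sub, Finset.sum_sub_distrib, ← Finset.sum_smul,
    sum_col_of_mem_doublyStochastic hP, one_smul]

theorem mix_mem {E : Type*} [AddCommGroup E] [Module ℝ E] (hP : P ∈ doublyStochastic ℝ n)
    {S : Set E} (hS : Convex ℝ S) {z : n → E} (hz : ∀ j, z j ∈ S) (i : n) :
    ∑ j, P j i • z j ∈ S :=
  hS.sum_mem (fun _ _ => nonneg_of_mem_doublyStochastic hP)
    (sum_col_of_mem_doublyStochastic hP i) fun j _ => hz j

theorem norm_mix_sub_le {E : Type*} [NormedAddCommGroup E] [NormedSpace ℝ E]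
    (hP : P ∈ doublyStochastic ℝ n) {z : n → E} {a : E} {R : ℝ} (hz : ∀ j, ‖z j - a‖ ≤ R)
    (i : n) : ‖∑ j, P j i • z j - a‖ ≤ R :=
  mem_closedBall_iff_norm.1 <|
    mix_mem hP (convex_closedBall a R) (fun j => mem_closedBall_iff_norm.2 (hz j)) i

theorem sum_norm_sq_mix_sub_le {E : Type*} [NormedAddCommGroup E] [NormedSpace ℝ E]
    (hP : P ∈ doublyStochastic ℝ n) (z : n → E) (a : E) :
    ∑ i, ‖∑ j, P j i • z j - a‖ ^ 2 ≤ ∑ j, ‖z j - a‖ ^ 2 := by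
  have hconv : ConvexOn ℝ Set.univ fun v : E => ‖v‖ ^ 2 :=
    (convexOn_norm convex_univ).pow (fun _ _ => norm_nonneg _) 2
  calc ∑ i, ‖∑ j, P j i • z j - a‖ ^ 2 ≤ ∑ i, ∑ j, P j i • ‖z j - a‖ ^ 2 :=
        Finset.sum_le_sum fun i _ => by
          rw [mix_sub hP]
          exact hconv.map_sum_le (fun _ _ => nonneg_of_mem_doublyStochastic hP)
            (sum_col_of_mem_doublyStochastic hP i) fun _ _ => trivial
    _ = ∑ j, ‖z j - a‖ ^ 2 := sum_mix hP fun j => ‖z j - a‖ ^ 2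

end Mix

theorem IsProjection.two_mul_inner_le {E : Type*} [NormedAddCommGroup E] [InnerProductSpace ℝ E]
    {S : Set E} {a b g z : E} {η : ℝ} (hS : Convex ℝ S) (hb : IsProjection S (a - η • g) b)
    (hz : z ∈ S) :
    2 * η * inner ℝ g (a - z) ≤ ‖a - z‖ ^ 2 - ‖b - z‖ ^ 2 + η ^ 2 * ‖g‖ ^ 2 := by
  have hexpand : ‖a - η • g - z‖ ^ 2 =
      ‖a - z‖ ^ 2 - 2 * η * inner ℝ g (a - z) + η ^ 2 * ‖g‖ ^ 2 := by
    rw [sub_right_comm, norm_sub_sq_real, inner_smul_right, norm_smul, mul_pow, Real.norm_eq_abs,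
      sq_abs, real_inner_comm]
    ring
  linarith [pow_le_pow_left₀ (norm_nonneg _) (hb.norm_sub_le hS hz) 2]

section Descent

variable {m : ℕ} {P : Matrix (Fin m) (Fin m) ℝ} {E : Type*} [NormedAddCommGroup E]
  [InnerProductSpace ℝ E]

/-- The iterates `z i t` of `m` agents that start from a common point of `S` and, in every round
`1 ≤ t ≤ T`, average with their neighbours, move by `-η • g i t` and project to `S`. The direction
`g i t` is arbitrary. -/
structure IsDescentRun (P : Matrix (Fin m) (Fin m) ℝ) (S : Set E) (η : ℝ) (T : ℕ)
    (z g : Fin m → ℕ → E) : Prop where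
  init : ∃ z₁ ∈ S, ∀ i, z i 1 = z₁
  step : ∀ i, ∀ t ∈ Finset.Icc 1 T,
    IsProjection S ((∑ j, P j i • z j t) - η • g i t) (z i (t + 1))

variable {S : Set E} {T : ℕ} {η G : ℝ} {z g : Fin m → ℕ → E}

theorem IsDescentRun.mem (h : IsDescentRun P S η T z g) (i : Fin m) {t : ℕ}
    (ht : t ∈ Finset.Icc 1 (T + 1)) : z i t ∈ S := by
  obtain ⟨z₁, hz₁, hinit⟩ := h.init
  obtain ⟨ht₁, htT⟩ := Finset.mem_Icc.1 ht
  rcases ht₁.eq_or_lt with rfl | hlt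
  · rwa [hinit i]
  · obtain ⟨s, rfl⟩ := Nat.exists_eq_add_of_lt hlt
    exact (h.step i (1 + s) (Finset.mem_Icc.2 ⟨by omega, by omega⟩)).1

theorem IsDescentRun.norm_succ_sub_mix_le (hP : P ∈ doublyStochastic ℝ (Fin m))
    (hS : Convex ℝ S) (hη : 0 ≤ η) (h : IsDescentRun P S η T z g) (i : Fin m) {t : ℕ}
    (ht : t ∈ Finset.Icc 1 T) : ‖z i (t + 1) - ∑ j, P j i • z j t‖ ≤ η * ‖g i t‖ := by
  have hmem : ∑ j, P j i • z j t ∈ S := mix_mem hP hS (z := fun j => z j t)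
    (fun j => h.mem j (Finset.Icc_subset_Icc_right T.le_succ ht)) i
  refine ((h.step i t ht).norm_sub_le hS hmem).trans_eq ?_
  rw [sub_sub_cancel_left, norm_neg, norm_smul, Real.norm_of_nonneg hη]

variable [FiniteDimensional ℝ E]

theorem IsNetwork.deviation_mix_le (hP : IsNetwork P) (z : Fin m → E) :
    deviation (fun i => ∑ j, P j i • z j) ≤ secondSingularValue P * deviation z := by
  have := hP.connected.nonempty
  have havg : average (fun i => ∑ j, P j i • z j) = average z := by
    rw [average, sum_mix hP.doublyStochastic, average]
  refine le_of_sq_le_sq ?_ (mul_nonneg (secondSingularValue_nonneg P) (deviation_nonneg z))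
  rw [mul_pow, deviation_sq, deviation_sq, havg]
  simp only [mix_sub hP.doublyStochastic]
  exact hP.sum_norm_sq_mix_le (sum_sub_average z)

theorem IsDescentRun.deviation_le (hP : IsNetwork P) (hS : Convex ℝ S) (hη : 0 ≤ η) (hG : 0 ≤ G)
    (h : IsDescentRun P S η T z g) (hg : ∀ i, ∀ t ∈ Finset.Icc 1 T, ‖g i t‖ ≤ G) {t : ℕ}
    (ht₁ : 1 ≤ t) (htT : t ≤ T + 1) :
    deviation (fun i => z i t) ≤ √m * (η * G) / (1 - secondSingularValue P) := by
  have hβ : 0 < 1 - secondSingularValue P := sub_pos.2 hP.secondSingularValue_lt_one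
  have := hP.connected.nonempty
  induction t, ht₁ using Nat.le_induction with
  | base =>
    obtain ⟨z₁, -, hinit⟩ := h.init
    simp only [hinit]
    rw [deviation_const]
    positivity
  | succ s hs ih =>
    have hsT : s ∈ Finset.Icc 1 T := Finset.mem_Icc.2 ⟨hs, by omega⟩
    set R := √m * (η * G) / (1 - secondSingularValue P) with hR
    have herror : deviation (fun i => z i (s + 1) - ∑ j, P j i • z j s) ≤ √m * (η * G) := by
      simpa using deviation_le_of_forall_norm_le fun i =>
        (h.norm_succ_sub_mix_le hP.doublyStochastic hS hη i hsT).trans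
          (mul_le_mul_of_nonneg_left (hg i s hsT) hη)
    calc deviation (fun i => z i (s + 1))
        = deviation (fun i => ∑ j, P j i • z j s + (z i (s + 1) - ∑ j, P j i • z j s)) := by
          simp only [add_sub_cancel]
      _ ≤ secondSingularValue P * R + √m * (η * G) := (deviation_add_le _ _).trans <|
          add_le_add ((hP.deviation_mix_le _).trans <| mul_le_mul_of_nonneg_left (ih (by omega))
            (secondSingularValue_nonneg P)) herror
      _ = R := by
          rw [hR]
          field_simp
          ring

theorem IsDescentRun.norm_sub_le (hP : IsNetwork P) (hS : Convex ℝ S) (hη : 0 ≤ η) (hG : 0 ≤ G)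
    (h : IsDescentRun P S η T z g) (hg : ∀ i, ∀ t ∈ Finset.Icc 1 T, ‖g i t‖ ≤ G) (i j : Fin m)
    {t : ℕ} (ht : t ∈ Finset.Icc 1 (T + 1)) :
    ‖z i t - z j t‖ ≤ 2 * √m * (η * G / (1 - secondSingularValue P)) := by
  obtain ⟨ht₁, htT⟩ := Finset.mem_Icc.1 ht
  calc ‖z i t - z j t‖ ≤ 2 * deviation (fun i => z i t) :=
        norm_sub_le_deviation (fun i => z i t) i j
    _ ≤ 2 * (√m * (η * G) / (1 - secondSingularValue P)) := by
        gcongr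
        exact h.deviation_le hP hS hη hG hg ht₁ htT
    _ = 2 * √m * (η * G / (1 - secondSingularValue P)) := by ring

theorem IsNetwork.le_div_one_sub (hP : IsNetwork P) {a : ℝ} (ha : 0 ≤ a) :
    a ≤ a / (1 - secondSingularValue P) :=
  le_div_self ha (sub_pos.2 hP.secondSingularValue_lt_one)
    (sub_le_self 1 (secondSingularValue_nonneg P))

theorem IsDescentRun.norm_succ_sub_le (hP : IsNetwork P) (hS : Convex ℝ S) (hη : 0 ≤ η)
    (hG : 0 ≤ G) (h : IsDescentRun P S η T z g) (hg : ∀ i, ∀ t ∈ Finset.Icc 1 T, ‖g i t‖ ≤ G)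
    (i : Fin m) {t : ℕ} (ht : t ∈ Finset.Icc 1 T) :
    ‖z i (t + 1) - z i t‖ ≤ (2 * √m + 1) * (η * G / (1 - secondSingularValue P)) := by
  have hmix := norm_mix_sub_le hP.doublyStochastic (fun j =>
    h.norm_sub_le hP hS hη hG hg j i (Finset.Icc_subset_Icc_right T.le_succ ht)) i
  have hstep : ‖z i (t + 1) - ∑ j, P j i • z j t‖ ≤ η * G :=
    (h.norm_succ_sub_mix_le hP.doublyStochastic hS hη i ht).trans
      (mul_le_mul_of_nonneg_left (hg i t ht) hη)
  linarith [norm_sub_le_norm_sub_add_norm_sub (z i (t + 1)) (∑ j, P j i • z j t) (z i t),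
    hP.le_div_one_sub (mul_nonneg hη hG)]

omit [FiniteDimensional ℝ E] in
theorem IsDescentRun.sum_inner_sub_le (hP : P ∈ doublyStochastic ℝ (Fin m)) (hS : Convex ℝ S)
    (hη : 0 < η) {R : ℝ} (h : IsDescentRun P S η T z g) {t : ℕ} (ht : t ∈ Finset.Icc 1 T)
    (hg : ∀ i, ‖g i t‖ ≤ G) (hz : ∀ i j, ‖z i t - z j t‖ ≤ R) {N : E} (hN : N ∈ S) :
    ∑ i, inner ℝ (g i t) (z i t - N) ≤
      (∑ i, ‖z i t - N‖ ^ 2 - ∑ i, ‖z i (t + 1) - N‖ ^ 2) / (2 * η) +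
        m * (η * G ^ 2 / 2 + G * R) := by
  have hagent : ∀ i, inner ℝ (g i t) (z i t - N) ≤
      (‖∑ j, P j i • z j t - N‖ ^ 2 - ‖z i (t + 1) - N‖ ^ 2) / (2 * η) +
        (η * G ^ 2 / 2 + G * R) := fun i => by
    set y := ∑ j, P j i • z j t
    have hsplit : inner ℝ (g i t) (z i t - N) =
        inner ℝ (g i t) (y - N) + inner ℝ (g i t) (z i t - y) := by
      rw [← inner_add_right, sub_add_sub_comm, add_comm y, add_sub_add_right_eq_sub]
    have hdisagree : inner ℝ (g i t) (z i t - y) ≤ G * R :=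
      (real_inner_le_norm _ _).trans <| mul_le_mul (hg i)
        (norm_sub_rev y (z i t) ▸ norm_mix_sub_le hP (fun j => hz j i) i) (norm_nonneg _)
        ((norm_nonneg _).trans (hg i))
    have hgsq : η ^ 2 * ‖g i t‖ ^ 2 ≤ η ^ 2 * G ^ 2 := by
      have := hg i
      gcongr
    have hgrad : inner ℝ (g i t) (y - N) ≤
        (‖y - N‖ ^ 2 - ‖z i (t + 1) - N‖ ^ 2) / (2 * η) + η * G ^ 2 / 2 := by
      rw [div_add_div _ _ (by positivity) two_ne_zero, le_div_iff₀ (by positivity)]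
      linarith [(h.step i t ht).two_mul_inner_le hS hN]
    linarith
  refine (Finset.sum_le_sum fun i _ => hagent i).trans ?_
  rw [Finset.sum_add_distrib, ← Finset.sum_div, Finset.sum_sub_distrib, Finset.sum_const,
    Finset.card_univ, Fintype.card_fin, nsmul_eq_mul]
  gcongr (?_ - _) / _ + _
  exact sum_norm_sq_mix_sub_le hP (fun j => z j t) N

theorem IsDescentRun.sum_sum_inner_sub_le (hP : IsNetwork P) (hS : Convex ℝ S) (hη : 0 < η)
    (hG : 0 ≤ G) (h : IsDescentRun P S η T z g) (hg : ∀ i, ∀ t ∈ Finset.Icc 1 T, ‖g i t‖ ≤ G)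
    {N : E} (hN : N ∈ S) :
    ∑ t ∈ Finset.Icc 1 T, ∑ i, inner ℝ (g i t) (z i t - N) ≤
      (∑ i, ‖z i 1 - N‖ ^ 2) / (2 * η) +
        T * (m * ((2 * √m + 1 / 2) * (η * G ^ 2 / (1 - secondSingularValue P)))) := by
  set V : ℕ → ℝ := fun t => ∑ i, ‖z i t - N‖ ^ 2
  have htelescope : ∑ t ∈ Finset.Icc 1 T, (V t - V (t + 1)) ≤ V 1 := by
    have hV : 0 ≤ V (T + 1) := by positivity
    have hsum := Finset.sum_Ico_sub V (Nat.le_add_left 1 T)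
    rw [Finset.Ico_add_one_right_eq_Icc] at hsum
    have hneg : ∑ t ∈ Finset.Icc 1 T, (V t - V (t + 1)) =
        -∑ t ∈ Finset.Icc 1 T, (V (t + 1) - V t) := by
      simp only [← Finset.sum_neg_distrib, neg_sub]
    linarith
  have hround : ∀ t ∈ Finset.Icc 1 T, ∑ i, inner ℝ (g i t) (z i t - N) ≤
      (V t - V (t + 1)) / (2 * η) +
        m * ((2 * √m + 1 / 2) * (η * G ^ 2 / (1 - secondSingularValue P))) := fun t ht => by
    refine (h.sum_inner_sub_le hP.doublyStochastic hS hη ht (fun i => hg i t ht) (fun i j =>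
      h.norm_sub_le hP hS hη.le hG hg i j (Finset.Icc_subset_Icc_right T.le_succ ht)) hN).trans ?_
    gcongr
    have hsq := hP.le_div_one_sub (a := η * G ^ 2) (by positivity)
    calc η * G ^ 2 / 2 + G * (2 * √m * (η * G / (1 - secondSingularValue P)))
        = 2 * √m * (η * G ^ 2 / (1 - secondSingularValue P)) + η * G ^ 2 / 2 := by ring
      _ ≤ _ := by linarith
  refine (Finset.sum_le_sum hround).trans ?_
  rw [Finset.sum_add_distrib, ← Finset.sum_div, Finset.sum_const, Nat.card_Icc,
    Nat.add_sub_cancel, nsmul_eq_mul]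
  gcongr

end Descent

/-! ### Matrices acting on Euclidean vectors -/

section Matrices

variable {l m n : ℕ}

@[simp]
theorem app_add (A : Matrix (Fin m) (Fin n) ℝ) (v v' : Vec n) :
    app A (v + v') = app A v + app A v' :=
  map_add _ _ _

@[simp]
theorem app_sub (A : Matrix (Fin m) (Fin n) ℝ) (v v' : Vec n) :
    app A (v - v') = app A v - app A v' :=
  map_sub _ _ _

@[simp]
theorem app_neg (A : Matrix (Fin m) (Fin n) ℝ) (v : Vec n) : app A (-v) = -app A v :=
  map_neg _ _

@[simp]
theorem app_zero (A : Matrix (Fin m) (Fin n) ℝ) : app A (0 : Vec n) = 0 :=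
  map_zero _

theorem app_sum {ι : Type*} (A : Matrix (Fin m) (Fin n) ℝ) (s : Finset ι) (f : ι → Vec n) :
    app A (∑ i ∈ s, f i) = ∑ i ∈ s, app A (f i) :=
  map_sum _ _ _

@[simp]
theorem zero_app (v : Vec n) : app (0 : Matrix (Fin m) (Fin n) ℝ) v = 0 := by
  simp [app]

@[simp]
theorem one_app (v : Vec n) : app (1 : Matrix (Fin n) (Fin n) ℝ) v = v := by
  ext i
  simp [app]

theorem add_app (A B : Matrix (Fin m) (Fin n) ℝ) (v : Vec n) :
    app (A + B) v = app A v + app B v := by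
  simp [app]

theorem sub_app (A B : Matrix (Fin m) (Fin n) ℝ) (v : Vec n) :
    app (A - B) v = app A v - app B v := by
  simp [app]

theorem smul_app (a : ℝ) (A : Matrix (Fin m) (Fin n) ℝ) (v : Vec n) :
    app (a • A) v = a • app A v := by
  simp [app]

theorem sum_app {ι : Type*} (s : Finset ι) (A : ι → Matrix (Fin m) (Fin n) ℝ) (v : Vec n) :
    app (∑ i ∈ s, A i) v = ∑ i ∈ s, app (A i) v := by
  simp [app]

theorem ite_app (p : Prop) [Decidable p] (A : Matrix (Fin m) (Fin n) ℝ) (v : Vec n) :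
    app (if p then A else 0) v = if p then app A v else 0 := by
  split_ifs <;> simp

theorem mul_app (A : Matrix (Fin l) (Fin m) ℝ) (B : Matrix (Fin m) (Fin n) ℝ) (v : Vec n) :
    app (A * B) v = app A (app B v) := by
  ext i
  simp [app, Matrix.toLpLin_apply, Matrix.mulVec_mulVec]

theorem norm_app_le_of_le {A : Matrix (Fin m) (Fin n) ℝ} {v : Vec n} {a b : ℝ} (hA : ‖A‖ ≤ a)
    (hv : ‖v‖ ≤ b) : ‖app A v‖ ≤ a * b :=
  (A.l2_opNorm_mulVec v).trans (mul_le_mul hA hv (norm_nonneg _) ((norm_nonneg _).trans hA))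

theorem norm_le_of_forall_norm_app_le {A : Matrix (Fin m) (Fin n) ℝ} {a : ℝ} (ha : 0 ≤ a)
    (h : ∀ v, ‖app A v‖ ≤ a * ‖v‖) : ‖A‖ ≤ a := by
  rw [Matrix.l2_opNorm_def]
  exact ContinuousLinearMap.opNorm_le_bound _ ha h

-- Mathlib's `norm_pow_le` does not apply: the norm of the empty identity matrix is `0`.
theorem norm_matrix_pow_le (A : Matrix (Fin n) (Fin n) ℝ) (j : ℕ) : ‖A ^ j‖ ≤ ‖A‖ ^ j := by
  rcases Nat.eq_zero_or_pos j with rfl | hj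
  · rw [pow_zero, pow_zero]
    exact norm_le_of_forall_norm_app_le zero_le_one fun v => by rw [one_app, one_mul]
  · exact norm_pow_le' A hj

theorem abs_apply_le_norm (A : Matrix (Fin m) (Fin n) ℝ) (i : Fin m) (j : Fin n) :
    |A i j| ≤ ‖A‖ := by
  have hsingle : ‖(EuclideanSpace.single j 1 : Vec n)‖ ≤ 1 := by simp
  have h := norm_app_le_of_le (le_refl ‖A‖) hsingle
  rw [mul_one] at h
  simpa [app, Matrix.toLpLin_apply] using
    (PiLp.norm_apply_le (app A (EuclideanSpace.single j 1)) i).trans h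

theorem norm_sq_le_sum_sq (A : Matrix (Fin m) (Fin n) ℝ) :
    ‖A‖ ^ 2 ≤ ∑ i, ∑ j, A i j ^ 2 := by
  refine Real.le_sqrt (norm_nonneg _) (by positivity) |>.1 ?_
  refine norm_le_of_forall_norm_app_le (Real.sqrt_nonneg _) fun v => ?_
  refine le_of_sq_le_sq ?_ (by positivity)
  rw [mul_pow, Real.sq_sqrt (by positivity), EuclideanSpace.real_norm_sq_eq,
    EuclideanSpace.real_norm_sq_eq, Finset.sum_mul]
  exact Finset.sum_le_sum fun i _ => Finset.sum_mul_sq_le_sq_mul_sq Finset.univ (A i ·) (v ·)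

theorem pair_sub_pair (v₁ v₂ : Vec m) (v₁' v₂' : Vec n) :
    pair v₁ v₁' - pair v₂ v₂' = pair (v₁ - v₂) (v₁' - v₂') :=
  rfl

theorem norm_pair_le (v : Vec m) (v' : Vec n) : ‖pair v v'‖ ≤ ‖v‖ + ‖v'‖ := by
  refine le_of_sq_le_sq ?_ (by positivity)
  have h : ‖pair v v'‖ ^ 2 = ‖v‖ ^ 2 + ‖v'‖ ^ 2 := WithLp.prod_norm_sq_eq_of_L2 _
  rw [h, add_sq]
  linarith [mul_nonneg (norm_nonneg v) (norm_nonneg v')]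

end Matrices

/-! ### Geometric sums -/

section Geometric

variable {γ : ℝ}

theorem sum_geometric_le (hγ₀ : 0 < γ) (hγ₁ : γ ≤ 1) (n : ℕ) :
    ∑ j ∈ Finset.range n, (1 - γ) ^ j ≤ 1 / γ := by
  have hr := sub_nonneg.2 hγ₁
  simpa using sum_le_hasSum (Finset.range n) (fun j _ => pow_nonneg hr j)
    (hasSum_geometric_of_lt_one hr (by linarith))

theorem sum_succ_mul_geometric_le (hγ₀ : 0 < γ) (hγ₁ : γ ≤ 1) (n : ℕ) :
    ∑ j ∈ Finset.range n, ((j : ℝ) + 1) * (1 - γ) ^ j ≤ 1 / γ ^ 2 := by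
  have hr := sub_nonneg.2 hγ₁
  have h := hasSum_choose_mul_geometric_of_norm_lt_one 1 (r := 1 - γ)
    (by rw [Real.norm_of_nonneg hr]; linarith)
  simpa using sum_le_hasSum (Finset.range n) (fun j _ => by positivity) h

theorem norm_sum_geometric_le {E : Type*} [NormedAddCommGroup E] (hγ₀ : 0 < γ) (hγ₁ : γ ≤ 1)
    {a : ℝ} (ha : 0 ≤ a) {n : ℕ} {F : ℕ → E} (hF : ∀ j < n, ‖F j‖ ≤ a * (1 - γ) ^ j) :
    ‖∑ j ∈ Finset.range n, F j‖ ≤ a / γ := by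
  refine (norm_sum_le_of_le _ fun j hj => hF j (Finset.mem_range.1 hj)).trans ?_
  rw [← Finset.mul_sum, div_eq_mul_one_div]
  exact mul_le_mul_of_nonneg_left (sum_geometric_le hγ₀ hγ₁ n) ha

theorem norm_sum_sub_truncated_le {E : Type*} [NormedAddCommGroup E] (hγ₀ : 0 < γ) (hγ₁ : γ ≤ 1)
    {a : ℝ} (ha : 0 ≤ a) {n N : ℕ} {F : ℕ → E} (hF : ∀ j < n, ‖F j‖ ≤ a * (1 - γ) ^ j) :
    ‖∑ j ∈ Finset.range n, F j - ∑ j ∈ Finset.range N, (if j < n then F j else 0)‖ ≤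
      a / γ * (1 - γ) ^ N := by
  have : 0 ≤ 1 - γ := sub_nonneg.2 hγ₁
  have hsplit : ∑ j ∈ Finset.range n, F j =
      ∑ j ∈ Finset.range (N + n), if j < n then F j else 0 := by
    rw [← Finset.sum_filter]
    refine Finset.sum_congr ?_ fun _ _ => rfl
    ext j
    simp only [Finset.mem_range, Finset.mem_filter]
    omega
  rw [hsplit, Finset.sum_range_add, add_sub_cancel_left, div_mul_eq_mul_div]
  refine norm_sum_geometric_le hγ₀ hγ₁ (by positivity) fun j _ => ?_
  split_ifs with h
  · exact (hF _ h).trans_eq (by rw [pow_add, mul_assoc])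
  · rw [norm_zero]
    positivity

end Geometric

/-! ### Disturbance feedback controllers -/

section Parameters

variable {H d₁ d₂ : ℕ} {κ γ : ℝ}

theorem block_add (M N : Param H d₁ d₂) (k : ℕ) : block (M + N) k = block M k + block N k := by
  ext a b
  simp only [block, Matrix.of_apply, Matrix.add_apply]
  split_ifs <;> simp

theorem block_smul (a : ℝ) (M : Param H d₁ d₂) (k : ℕ) : block (a • M) k = a • block M k := by
  ext i j
  simp only [block, Matrix.of_apply, Matrix.smul_apply]
  split_ifs <;> simp

theorem convex_feasible : Convex ℝ (feasible H d₁ d₂ κ γ) := by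
  intro M hM N hN a b ha hb hab k hk
  rw [block_add, block_smul, block_smul, ← mem_closedBall_zero_iff]
  exact convex_closedBall 0 _ (mem_closedBall_zero_iff.2 (hM k hk))
    (mem_closedBall_zero_iff.2 (hN k hk)) ha hb hab

theorem norm_sq_eq_sum_block (M : Param H d₁ d₂) :
    ‖M‖ ^ 2 = ∑ k ∈ Finset.range H, ∑ a, ∑ b, block M k a b ^ 2 := by
  rw [EuclideanSpace.real_norm_sq_eq, Fintype.sum_prod_type, ← Fin.sum_univ_eq_sum_range
    (fun k => ∑ a, ∑ b, block M k a b ^ 2)]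
  refine Finset.sum_congr rfl fun k _ => ?_
  rw [Fintype.sum_prod_type]
  simp [block]

theorem sum_norm_block_le (M : Param H d₁ d₂) :
    ∑ k ∈ Finset.range H, ‖block M k‖ ≤ √H * ‖M‖ := by
  have hcs := sq_sum_le_card_mul_sum_sq (s := Finset.range H) (f := fun k => ‖block M k‖)
  rw [Finset.card_range] at hcs
  refine le_of_sq_le_sq (hcs.trans ?_) (by positivity)
  rw [mul_pow, Real.sq_sqrt (by positivity), norm_sq_eq_sum_block]
  gcongr with k
  exact norm_sq_le_sum_sq _

theorem norm_sq_le_of_mem_feasible (hκ : 0 ≤ κ) (hγ₀ : 0 ≤ γ) (hγ₁ : γ ≤ 1) {M : Param H d₁ d₂}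
    (hM : M ∈ feasible H d₁ d₂ κ γ) : ‖M‖ ^ 2 ≤ H * (d₂ * d₁ * (2 * κ ^ 3) ^ 2) := by
  have hentry : ∀ k ∈ Finset.range H, ∀ a b, block M k a b ^ 2 ≤ (2 * κ ^ 3) ^ 2 := by
    intro k hk a b
    have hpow : (1 - γ) ^ k ≤ 1 := pow_le_one₀ (by linarith) (by linarith)
    rw [← sq_abs]
    gcongr
    exact (abs_apply_le_norm (block M k) a b).trans ((hM k (Finset.mem_range.1 hk)).trans
      (mul_le_of_le_one_right (by positivity) hpow))
  rw [norm_sq_eq_sum_block]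
  calc _ ≤ ∑ k ∈ Finset.range H, ∑ _a : Fin d₂, ∑ _b : Fin d₁, (2 * κ ^ 3) ^ 2 :=
        Finset.sum_le_sum fun k hk => Finset.sum_le_sum fun a _ => Finset.sum_le_sum fun b _ =>
          hentry k hk a b
    _ = _ := by
        simp only [Finset.sum_const, Finset.card_range, Finset.card_univ, Fintype.card_fin,
          nsmul_eq_mul]
        ring

theorem norm_sub_sq_le_of_mem_feasible (hκ : 0 ≤ κ) (hγ₀ : 0 ≤ γ) (hγ₁ : γ ≤ 1)
    {M N : Param H d₁ d₂} (hM : M ∈ feasible H d₁ d₂ κ γ) (hN : N ∈ feasible H d₁ d₂ κ γ) :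
    ‖M - N‖ ^ 2 ≤ 4 * (H * (d₂ * d₁ * (2 * κ ^ 3) ^ 2)) := by
  have hsub : ‖M - N‖ ^ 2 ≤ 2 * (‖M‖ ^ 2 + ‖N‖ ^ 2) :=
    (pow_le_pow_left₀ (norm_nonneg _) (norm_sub_le M N) 2).trans add_sq_le
  linarith [norm_sq_le_of_mem_feasible hκ hγ₀ hγ₁ hM, norm_sq_le_of_mem_feasible hκ hγ₀ hγ₁ hN]

end Parameters

section Feedforward

variable {H d₁ d₂ T t : ℕ} {κ γ W : ℝ} {w w' : ℕ → Vec d₁}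

theorem norm_past_le (hW : 0 ≤ W) (hw : ∀ t ∈ Finset.Icc 1 T, ‖w t‖ ≤ W) (ht : t ≤ T + 1) {k : ℕ}
    (hk : 1 ≤ k) : ‖past w t k‖ ≤ W := by
  rw [past]
  split_ifs with h
  · exact hw _ (Finset.mem_Icc.2 ⟨by omega, by omega⟩)
  · rwa [norm_zero]

theorem past_congr (h : ∀ t ∈ Finset.Icc 1 T, w t = w' t) (ht : t ≤ T + 1) {k : ℕ} (hk : 1 ≤ k) :
    past w t k = past w' t k := by
  rw [past, past]
  split_ifs with hkt
  · exact h _ (Finset.mem_Icc.2 ⟨by omega, by omega⟩)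
  · rfl

theorem past_add_one_add (w : ℕ → Vec d₁) (t j k : ℕ) :
    past w t (j + 1 + k) = past w (t - 1 - j) k := by
  rw [past, past]
  have hlt : (j + 1 + k < t) ↔ (k < t - 1 - j) := by omega
  have hsub : t - (j + 1 + k) = t - 1 - j - k := by omega
  simp only [hlt, hsub]

theorem feedforward_eq_sum_range (M : Param H d₁ d₂) (w : ℕ → Vec d₁) (t : ℕ) :
    feedforward M w t = ∑ k ∈ Finset.range H, app (block M k) (past w t (k + 1)) := by
  rw [feedforward, Finset.range_eq_Ico, ← Finset.Ico_add_one_right_eq_Icc]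
  exact (Finset.sum_Ico_add' (fun k => app (block M (k - 1)) (past w t k)) 0 H 1).symm

theorem feedforward_time_zero (M : Param H d₁ d₂) (w : ℕ → Vec d₁) : feedforward M w 0 = 0 := by
  simp [feedforward, past]

theorem feedforward_congr (h : ∀ t ∈ Finset.Icc 1 T, w t = w' t) (ht : t ≤ T + 1)
    (M : Param H d₁ d₂) : feedforward M w t = feedforward M w' t := by
  simp only [feedforward_eq_sum_range]
  exact Finset.sum_congr rfl fun k _ => by rw [past_congr h ht (by omega)]

/-- The feedforward term as a linear function of the parameter. -/
noncomputable def feedforwardLin (H d₂ : ℕ) (w : ℕ → Vec d₁) (t : ℕ) :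
    Param H d₁ d₂ →ₗ[ℝ] Vec d₂ where
  toFun M := feedforward M w t
  map_add' M N := by simp [feedforward, block_add, add_app, Finset.sum_add_distrib]
  map_smul' a M := by simp [feedforward, block_smul, smul_app, Finset.smul_sum]

theorem feedforward_sub (M N : Param H d₁ d₂) (w : ℕ → Vec d₁) (t : ℕ) :
    feedforward (M - N) w t = feedforward M w t - feedforward N w t :=
  map_sub (feedforwardLin H d₂ w t) M N

theorem feedforward_zero (H d₂ : ℕ) (w : ℕ → Vec d₁) (t : ℕ) :
    feedforward (0 : Param H d₁ d₂) w t = 0 :=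
  map_zero (feedforwardLin H d₂ w t)

theorem norm_feedforward_le_sum (hW : 0 ≤ W) (hw : ∀ t ∈ Finset.Icc 1 T, ‖w t‖ ≤ W)
    (ht : t ≤ T + 1) (M : Param H d₁ d₂) :
    ‖feedforward M w t‖ ≤ (∑ k ∈ Finset.range H, ‖block M k‖) * W := by
  rw [feedforward_eq_sum_range, Finset.sum_mul]
  exact norm_sum_le_of_le _ fun k _ => norm_app_le_of_le le_rfl (norm_past_le hW hw ht (by omega))

theorem norm_feedforward_le (hW : 0 ≤ W) (hw : ∀ t ∈ Finset.Icc 1 T, ‖w t‖ ≤ W) (ht : t ≤ T + 1)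
    (M : Param H d₁ d₂) : ‖feedforward M w t‖ ≤ W * √H * ‖M‖ := by
  refine (norm_feedforward_le_sum hW hw ht M).trans ?_
  linarith [mul_le_mul_of_nonneg_right (sum_norm_block_le M) hW]

/-- A bound on the feedforward terms of feasible parameters. -/
noncomputable def feedforwardBound (κ γ W : ℝ) : ℝ := 2 * κ ^ 3 * W / γ

theorem norm_feedforward_le_of_mem_feasible (hW : 0 ≤ W) (hw : ∀ t ∈ Finset.Icc 1 T, ‖w t‖ ≤ W)
    (hκ : 0 ≤ κ) (hγ₀ : 0 < γ) (hγ₁ : γ ≤ 1) (ht : t ≤ T + 1) {M : Param H d₁ d₂}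
    (hM : M ∈ feasible H d₁ d₂ κ γ) : ‖feedforward M w t‖ ≤ feedforwardBound κ γ W := by
  rw [feedforward_eq_sum_range]
  refine norm_sum_geometric_le hγ₀ hγ₁ (by positivity) fun k hk => ?_
  exact (norm_app_le_of_le (hM k hk) (norm_past_le hW hw ht (by omega))).trans_eq (by ring)

end Feedforward

/-! ### Closed loops -/

section StronglyStable

variable {d₁ d₂ : ℕ} {A : Matrix (Fin d₁) (Fin d₁) ℝ} {B : Matrix (Fin d₁) (Fin d₂) ℝ}
  {K K' : Matrix (Fin d₂) (Fin d₁) ℝ} {κ γ : ℝ}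

theorem StronglyStable.pos (hK : StronglyStable κ γ A B K) : 0 < κ := hK.1

theorem StronglyStable.rate_pos (hK : StronglyStable κ γ A B K) : 0 < γ := hK.2.1

theorem StronglyStable.rate_le_one (hK : StronglyStable κ γ A B K) : γ ≤ 1 := hK.2.2.1

theorem StronglyStable.norm_le (hK : StronglyStable κ γ A B K) : ‖K‖ ≤ κ := hK.2.2.2.1

theorem StronglyStable.norm_pow_le (hK : StronglyStable κ γ A B K) (j : ℕ) :
    ‖(A - B * K) ^ j‖ ≤ κ ^ 2 * (1 - γ) ^ j := by
  obtain ⟨hκ, -, -, -, L, Q, ⟨Q, rfl⟩, hA, hL, hQ, hQi⟩ := hK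
  rw [hA, ← Matrix.coe_units_inv, Units.conj_pow, Matrix.coe_units_inv]
  have hLj : ‖L ^ j‖ ≤ (1 - γ) ^ j :=
    (norm_matrix_pow_le L j).trans (pow_le_pow_left₀ (norm_nonneg L) hL j)
  have hr : 0 ≤ (1 - γ) ^ j := (norm_nonneg _).trans hLj
  calc _ ≤ κ * (1 - γ) ^ j * κ :=
        (Matrix.l2_opNorm_mul _ _).trans (mul_le_mul ((Matrix.l2_opNorm_mul _ _).trans
          (mul_le_mul hQ hLj (norm_nonneg _) hκ.le)) hQi (norm_nonneg _) (by positivity))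
    _ = κ ^ 2 * (1 - γ) ^ j := by ring

theorem StronglyStable.norm_pow_app_le (hK : StronglyStable κ γ A B K) (j : ℕ) {v : Vec d₁}
    {a : ℝ} (hv : ‖v‖ ≤ a) : ‖app ((A - B * K) ^ j) v‖ ≤ κ ^ 2 * a * (1 - γ) ^ j :=
  (norm_app_le_of_le (hK.norm_pow_le j) hv).trans_eq (by ring)

theorem StronglyStable.norm_sum_pow_app_le (hK : StronglyStable κ γ A B K) {v : ℕ → Vec d₁} {n : ℕ}
    {a b : ℝ} (ha : 0 ≤ a) (hb : 0 ≤ b) (hv : ∀ j < n, ‖v j‖ ≤ a + b * (j + 1)) :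
    ‖∑ j ∈ Finset.range n, app ((A - B * K) ^ j) (v j)‖ ≤ κ ^ 2 * (a / γ + b / γ ^ 2) := by
  calc _ ≤ ∑ j ∈ Finset.range n, κ ^ 2 * (a * (1 - γ) ^ j + b * ((j + 1) * (1 - γ) ^ j)) :=
        norm_sum_le_of_le _ fun j hj =>
          (hK.norm_pow_app_le j (hv j (Finset.mem_range.1 hj))).trans_eq (by ring)
    _ = κ ^ 2 * (a * ∑ j ∈ Finset.range n, (1 - γ) ^ j +
          b * ∑ j ∈ Finset.range n, ((j : ℝ) + 1) * (1 - γ) ^ j) := by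
        rw [← Finset.mul_sum, Finset.sum_add_distrib, ← Finset.mul_sum, ← Finset.mul_sum]
    _ ≤ κ ^ 2 * (a * (1 / γ) + b * (1 / γ ^ 2)) := by
        gcongr
        · exact sum_geometric_le hK.rate_pos hK.rate_le_one n
        · exact sum_succ_mul_geometric_le hK.rate_pos hK.rate_le_one n
    _ = κ ^ 2 * (a / γ + b / γ ^ 2) := by ring

theorem StronglyStable.norm_sub_le (hK : StronglyStable κ γ A B K)
    (hK' : StronglyStable κ γ A B K') : ‖K - K'‖ ≤ 2 * κ :=
  (norm_sub_le_of_le hK.norm_le hK'.norm_le).trans_eq (two_mul κ).symm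

theorem state_eq_sum {T : ℕ} {D : Matrix (Fin d₁) (Fin d₁) ℝ} {x v : ℕ → Vec d₁} (h1 : x 1 = 0)
    (hx : ∀ t ∈ Finset.Icc 1 T, x (t + 1) = app D (x t) + v t) {n : ℕ} (hn : n ≤ T) :
    x (n + 1) = ∑ j ∈ Finset.range n, app (D ^ j) (v (n - j)) := by
  induction n with
  | zero => simpa using h1
  | succ n ih =>
    rw [hx (n + 1) (Finset.mem_Icc.2 ⟨by omega, hn⟩), ih (by omega), Finset.sum_range_succ',
      app_sum]
    congr 1
    · refine Finset.sum_congr rfl fun j _ => ?_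
      rw [pow_succ', mul_app, Nat.add_sub_add_right]
    · simp

end StronglyStable

section Surrogates

variable {H d₁ d₂ T t : ℕ} {A : Matrix (Fin d₁) (Fin d₁) ℝ} {B : Matrix (Fin d₁) (Fin d₂) ℝ}
  {K : Matrix (Fin d₂) (Fin d₁) ℝ} {w w' : ℕ → Vec d₁}

/-- The surrogate state-action pair `(y_t(M), v_t(M))`. -/
noncomputable def surrogatePair (A : Matrix (Fin d₁) (Fin d₁) ℝ) (B : Matrix (Fin d₁) (Fin d₂) ℝ)
    (K : Matrix (Fin d₂) (Fin d₁) ℝ) (w : ℕ → Vec d₁) (t : ℕ) (M : Param H d₁ d₂) : Pair d₁ d₂ :=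
  pair (surrogateState A B K w t M) (surrogateAction A B K w t M)

theorem sum_app_block_eq_app_feedforward (D : Matrix (Fin d₁) (Fin d₂) ℝ) (w : ℕ → Vec d₁) (t : ℕ)
    (M : Param H d₁ d₂) {j : ℕ} (hj : j ≤ H) :
    ∑ i ∈ Finset.range (2 * H + 1),
      app (if j + 1 ≤ i ∧ i ≤ j + H then D * block M (i - j - 1) else 0) (past w t (i + 1)) =
      app D (feedforward M w (t - 1 - j)) := by
  have hfilter : {i ∈ Finset.range (2 * H + 1) | j + 1 ≤ i ∧ i ≤ j + H} =
      (Finset.Icc 1 H).map (addLeftEmbedding j) := by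
    rw [Finset.map_add_left_Icc]
    ext i
    simp only [Finset.mem_filter, Finset.mem_range, Finset.mem_Icc]
    omega
  simp only [ite_app]
  rw [← Finset.sum_filter, hfilter, Finset.sum_map, feedforward, app_sum]
  refine Finset.sum_congr rfl fun k _ => ?_
  rw [addLeftEmbedding_apply, mul_app, Nat.add_sub_cancel_left, add_right_comm j k 1,
    past_add_one_add]

theorem surrogateState_eq (A : Matrix (Fin d₁) (Fin d₁) ℝ) (B : Matrix (Fin d₁) (Fin d₂) ℝ)
    (K : Matrix (Fin d₂) (Fin d₁) ℝ) (w : ℕ → Vec d₁) (t : ℕ) (M : Param H d₁ d₂) :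
    surrogateState A B K w t M = ∑ j ∈ Finset.range (H + 1),
      app ((A - B * K) ^ j) (past w t (j + 1) + app B (feedforward M w (t - 1 - j))) := by
  have hfilter : {i ∈ Finset.range (2 * H + 1) | i ≤ H} = Finset.range (H + 1) := by
    ext i
    simp only [Finset.mem_filter, Finset.mem_range]
    omega
  simp only [surrogateState, transfer, add_app, sum_app, app_add, Finset.sum_add_distrib]
  congr 1
  · simp only [ite_app]
    rw [← Finset.sum_filter, hfilter]
  · rw [Finset.sum_comm]
    refine Finset.sum_congr rfl fun j hj => ?_
    rw [sum_app_block_eq_app_feedforward _ w t M (Finset.mem_range_succ_iff.1 hj), mul_app]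

theorem surrogateState_succ (A : Matrix (Fin d₁) (Fin d₁) ℝ) (B : Matrix (Fin d₁) (Fin d₂) ℝ)
    (K : Matrix (Fin d₂) (Fin d₁) ℝ) (w : ℕ → Vec d₁) (n : ℕ) (M : Param H d₁ d₂) :
    surrogateState A B K w (n + 1) M = ∑ j ∈ Finset.range (H + 1),
      if j < n then app ((A - B * K) ^ j) (w (n - j) + app B (feedforward M w (n - j))) else 0 := by
  rw [surrogateState_eq]
  refine Finset.sum_congr rfl fun j _ => ?_
  simp only [Nat.add_sub_cancel, past, Nat.add_lt_add_iff_right, Nat.add_sub_add_right]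
  split_ifs with h
  · rfl
  · rw [Nat.sub_eq_zero_of_le (by omega), feedforward_time_zero, app_zero, add_zero, app_zero]

theorem surrogatePair_congr (h : ∀ t ∈ Finset.Icc 1 T, w t = w' t) (ht : t ≤ T + 1)
    (M : Param H d₁ d₂) : surrogatePair A B K w t M = surrogatePair A B K w' t M := by
  have hstate : surrogateState A B K w t M = surrogateState A B K w' t M :=
    Finset.sum_congr rfl fun k _ => by rw [past_congr h ht (by omega)]
  rw [surrogatePair, surrogatePair, surrogateAction, surrogateAction, hstate,
    feedforward_congr h ht]

end Surrogates

/-- The closed loop of the strongly stable policy `K` on the system `(A, B)`, with noise bounded by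
`W` in the rounds `1, …, T`. -/
structure IsBoundedLoop {d₁ d₂ : ℕ} (κ γ W : ℝ) (A : Matrix (Fin d₁) (Fin d₁) ℝ)
    (B : Matrix (Fin d₁) (Fin d₂) ℝ) (K : Matrix (Fin d₂) (Fin d₁) ℝ) (T : ℕ) (w : ℕ → Vec d₁) :
    Prop where
  stable : StronglyStable κ γ A B K
  norm_input_le : ‖B‖ ≤ κ
  noise_nonneg : 0 ≤ W
  norm_noise_le : ∀ t ∈ Finset.Icc 1 T, ‖w t‖ ≤ W

/-- A bound on the states reached by feasible controllers. -/
noncomputable def stateBound (κ γ W : ℝ) : ℝ := κ ^ 2 * (W + κ * feedforwardBound κ γ W) / γ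

/-- A bound on the states and the actions of feasible controllers. -/
noncomputable def radius (κ γ W : ℝ) : ℝ :=
  stateBound κ γ W + (κ * stateBound κ γ W + feedforwardBound κ γ W)

section Bounds

variable {κ γ W : ℝ}

theorem feedforwardBound_nonneg (hκ : 0 ≤ κ) (hγ : 0 ≤ γ) (hW : 0 ≤ W) :
    0 ≤ feedforwardBound κ γ W := by
  unfold feedforwardBound
  positivity

theorem stateBound_nonneg (hκ : 0 ≤ κ) (hγ : 0 ≤ γ) (hW : 0 ≤ W) : 0 ≤ stateBound κ γ W := by
  unfold stateBound feedforwardBound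
  positivity

theorem radius_nonneg (hκ : 0 ≤ κ) (hγ : 0 ≤ γ) (hW : 0 ≤ W) : 0 ≤ radius κ γ W := by
  unfold radius stateBound feedforwardBound
  positivity

end Bounds

namespace IsBoundedLoop

variable {H d₁ d₂ T t : ℕ} {A : Matrix (Fin d₁) (Fin d₁) ℝ} {B : Matrix (Fin d₁) (Fin d₂) ℝ}
  {K : Matrix (Fin d₂) (Fin d₁) ℝ} {κ γ W : ℝ} {w x : ℕ → Vec d₁} {z : ℕ → Vec d₂}
  {N : Param H d₁ d₂}

theorem norm_feedforward_le (hL : IsBoundedLoop κ γ W A B K T w)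
    (hN : N ∈ feasible H d₁ d₂ κ γ) (ht : t ≤ T + 1) :
    ‖feedforward N w t‖ ≤ feedforwardBound κ γ W :=
  norm_feedforward_le_of_mem_feasible hL.noise_nonneg hL.norm_noise_le hL.stable.pos.le
    hL.stable.rate_pos hL.stable.rate_le_one ht hN

theorem norm_add_app_feedforward_le (hL : IsBoundedLoop κ γ W A B K T w)
    (hN : N ∈ feasible H d₁ d₂ κ γ) (ht : t ∈ Finset.Icc 1 T) :
    ‖w t + app B (feedforward N w t)‖ ≤ W + κ * feedforwardBound κ γ W :=
  norm_add_le_of_le (hL.norm_noise_le t ht) (norm_app_le_of_le hL.norm_input_le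
    (hL.norm_feedforward_le hN ((Finset.mem_Icc.1 ht).2.trans T.le_succ)))

theorem feedforwardBound_nonneg (hL : IsBoundedLoop κ γ W A B K T w) :
    0 ≤ feedforwardBound κ γ W :=
  DistControl.feedforwardBound_nonneg hL.stable.pos.le hL.stable.rate_pos.le hL.noise_nonneg

theorem stateBound_nonneg (hL : IsBoundedLoop κ γ W A B K T w) : 0 ≤ stateBound κ γ W :=
  DistControl.stateBound_nonneg hL.stable.pos.le hL.stable.rate_pos.le hL.noise_nonneg

theorem radius_nonneg (hL : IsBoundedLoop κ γ W A B K T w) : 0 ≤ radius κ γ W :=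
  DistControl.radius_nonneg hL.stable.pos.le hL.stable.rate_pos.le hL.noise_nonneg

theorem norm_state_le (hL : IsBoundedLoop κ γ W A B K T w) {v : ℕ → Vec d₁} (h1 : x 1 = 0)
    (hx : ∀ t ∈ Finset.Icc 1 T, x (t + 1) = app (A - B * K) (x t) + v t)
    (hv : ∀ t ∈ Finset.Icc 1 T, ‖v t‖ ≤ W + κ * feedforwardBound κ γ W)
    (ht : t ∈ Finset.Icc 1 T) : ‖x t‖ ≤ stateBound κ γ W := by
  obtain ⟨ht1, htT⟩ := Finset.mem_Icc.1 ht
  obtain ⟨n, rfl⟩ : ∃ n, t = n + 1 := ⟨t - 1, by omega⟩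
  have hV : 0 ≤ W + κ * feedforwardBound κ γ W := (norm_nonneg _).trans (hv _ ht)
  rw [state_eq_sum h1 hx (by omega)]
  refine norm_sum_geometric_le hL.stable.rate_pos hL.stable.rate_le_one (by positivity)
    fun j hj => ?_
  exact hL.stable.norm_pow_app_le j (hv _ (Finset.mem_Icc.2 ⟨by omega, by omega⟩))

theorem norm_neg_app_add_le (hL : IsBoundedLoop κ γ W A B K T w) {y : Vec d₁} {v : Vec d₂}
    (hy : ‖y‖ ≤ stateBound κ γ W) (hv : ‖v‖ ≤ feedforwardBound κ γ W) :
    ‖y‖ ≤ radius κ γ W ∧ ‖-app K y + v‖ ≤ radius κ γ W := by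
  have hact : ‖-app K y + v‖ ≤ κ * stateBound κ γ W + feedforwardBound κ γ W :=
    norm_add_le_of_le (by rw [norm_neg]; exact norm_app_le_of_le hL.stable.norm_le hy) hv
  rw [radius]
  have hX := hL.stateBound_nonneg
  have hZ := hL.feedforwardBound_nonneg
  have hKX := mul_nonneg hL.stable.pos.le hX
  constructor <;> linarith

theorem norm_surrogate_le (hL : IsBoundedLoop κ γ W A B K T w)
    (hN : N ∈ feasible H d₁ d₂ κ γ) (ht : t ≤ T + 1) :
    ‖surrogateState A B K w t N‖ ≤ radius κ γ W ∧
      ‖surrogateAction A B K w t N‖ ≤ radius κ γ W := by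
  refine hL.norm_neg_app_add_le ?_ (hL.norm_feedforward_le hN ht)
  have hκ := hL.stable.pos
  have hW := hL.noise_nonneg
  have hZ := hL.feedforwardBound_nonneg
  rw [surrogateState_eq]
  refine norm_sum_geometric_le hL.stable.rate_pos hL.stable.rate_le_one (by positivity)
    fun j _ => hL.stable.norm_pow_app_le j ?_
  exact norm_add_le_of_le (norm_past_le hW hL.norm_noise_le ht (by omega))
    (norm_app_le_of_le hL.norm_input_le (hL.norm_feedforward_le hN (by omega)))

theorem norm_sum_sub_surrogateState_le (hL : IsBoundedLoop κ γ W A B K T w)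
    (hN : N ∈ feasible H d₁ d₂ κ γ) {n : ℕ} (hn : n ≤ T) :
    ‖∑ j ∈ Finset.range n, app ((A - B * K) ^ j) (w (n - j) + app B (feedforward N w (n - j))) -
      surrogateState A B K w (n + 1) N‖ ≤ stateBound κ γ W * (1 - γ) ^ H := by
  have hκ := hL.stable.pos
  have hγ := hL.stable.rate_pos
  have hr := sub_nonneg.2 hL.stable.rate_le_one
  have hW := hL.noise_nonneg
  have hZ := hL.feedforwardBound_nonneg
  have hX := hL.stateBound_nonneg
  rw [surrogateState_succ]
  refine (norm_sum_sub_truncated_le (a := κ ^ 2 * (W + κ * feedforwardBound κ γ W)) hγ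
    hL.stable.rate_le_one (by positivity) fun j hj => hL.stable.norm_pow_app_le j
      (hL.norm_add_app_feedforward_le hN (Finset.mem_Icc.2 ⟨by omega, by omega⟩))).trans ?_
  exact mul_le_mul_of_nonneg_left (pow_le_pow_of_le_one hr (by linarith) H.le_succ) hX

theorem norm_state_sub_surrogateState_le (hL : IsBoundedLoop κ γ W A B K T w)
    (hN : N ∈ feasible H d₁ d₂ κ γ) (h1 : x 1 = 0)
    (hx : ∀ t ∈ Finset.Icc 1 T, x (t + 1) = app (A - B * K) (x t) + (w t + app B (z t)))
    (ht : t ∈ Finset.Icc 1 T) {a b : ℝ} (ha : 0 ≤ a) (hb : 0 ≤ b)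
    (hz : ∀ s ∈ Finset.Icc 1 t, ‖z s - feedforward N w s‖ ≤ a + b * (t - s)) :
    ‖x t - surrogateState A B K w t N‖ ≤
      κ ^ 3 * (a / γ + b / γ ^ 2) + stateBound κ γ W * (1 - γ) ^ H := by
  have hκ := hL.stable.pos
  obtain ⟨ht1, htT⟩ := Finset.mem_Icc.1 ht
  obtain ⟨n, rfl⟩ : ∃ n, t = n + 1 := ⟨t - 1, by omega⟩
  have hsplit : x (n + 1) = ∑ j ∈ Finset.range n, app ((A - B * K) ^ j)
        (app B (z (n - j) - feedforward N w (n - j))) +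
      ∑ j ∈ Finset.range n,
        app ((A - B * K) ^ j) (w (n - j) + app B (feedforward N w (n - j))) := by
    rw [state_eq_sum h1 hx (by omega), ← Finset.sum_add_distrib]
    refine Finset.sum_congr rfl fun j _ => ?_
    simp only [app_add, app_sub]
    abel
  have hinput : ∀ j < n, ‖app B (z (n - j) - feedforward N w (n - j))‖ ≤
      κ * a + κ * b * (j + 1) := by
    intro j hj
    have hage : ((n + 1 : ℕ) : ℝ) - ((n - j : ℕ) : ℝ) = j + 1 := by
      rw [Nat.cast_sub hj.le]
      push_cast
      ring
    have h := hz (n - j) (Finset.mem_Icc.2 ⟨by omega, by omega⟩)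
    rw [hage] at h
    exact (norm_app_le_of_le hL.norm_input_le h).trans_eq (by ring)
  rw [hsplit, add_sub_assoc]
  refine norm_add_le_of_le ?_ (hL.norm_sum_sub_surrogateState_le hN (by omega))
  exact (hL.stable.norm_sum_pow_app_le (by positivity) (by positivity) hinput).trans_eq (by ring)

theorem norm_pair_sub_surrogatePair_le (hL : IsBoundedLoop κ γ W A B K T w)
    (hN : N ∈ feasible H d₁ d₂ κ γ) (h1 : x 1 = 0)
    (hx : ∀ t ∈ Finset.Icc 1 T, x (t + 1) = app (A - B * K) (x t) + (w t + app B (z t)))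
    (ht : t ∈ Finset.Icc 1 T) {a b : ℝ} (ha : 0 ≤ a) (hb : 0 ≤ b)
    (hz : ∀ s ∈ Finset.Icc 1 t, ‖z s - feedforward N w s‖ ≤ a + b * (t - s)) :
    ‖pair (x t) (-app K (x t) + z t) - surrogatePair A B K w t N‖ ≤
      (1 + κ) * (κ ^ 3 * (a / γ + b / γ ^ 2) + stateBound κ γ W * (1 - γ) ^ H) + a := by
  set e := κ ^ 3 * (a / γ + b / γ ^ 2) + stateBound κ γ W * (1 - γ) ^ H
  have hstate : ‖x t - surrogateState A B K w t N‖ ≤ e :=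
    hL.norm_state_sub_surrogateState_le hN h1 hx ht ha hb hz
  have hzt : ‖z t - feedforward N w t‖ ≤ a := by
    simpa using hz t (Finset.right_mem_Icc.2 (Finset.mem_Icc.1 ht).1)
  have hact : ‖-app K (x t - surrogateState A B K w t N) + (z t - feedforward N w t)‖ ≤ κ * e + a :=
    norm_add_le_of_le (by rw [norm_neg]; exact norm_app_le_of_le hL.stable.norm_le hstate) hzt
  have hsplit : pair (x t) (-app K (x t) + z t) - surrogatePair A B K w t N =
      pair (x t - surrogateState A B K w t N)
        (-app K (x t - surrogateState A B K w t N) + (z t - feedforward N w t)) := by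
    rw [surrogatePair, pair_sub_pair, surrogateAction, app_sub]
    congr 1
    abel
  rw [hsplit]
  linarith [norm_pair_le (x t - surrogateState A B K w t N)
    (-app K (x t - surrogateState A B K w t N) + (z t - feedforward N w t))]

end IsBoundedLoop

/-! ### Linear policies -/

section LinearPolicies

variable {m H d₁ d₂ T t : ℕ} {A : Matrix (Fin d₁) (Fin d₁) ℝ} {B : Matrix (Fin d₁) (Fin d₂) ℝ}
  {K K' : Matrix (Fin d₂) (Fin d₁) ℝ} {κ γ W G : ℝ} {w : ℕ → Vec d₁}
  {c : Fin m → ℕ → Pair d₁ d₂ → ℝ}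

theorem linearState_succ (ht : 1 ≤ t) :
    linearState A B w K (t + 1) = app (A - B * K) (linearState A B w K t) + w t := by
  obtain ⟨s, rfl⟩ : ∃ s, t = s + 1 := ⟨t - 1, by omega⟩
  rw [linearState, sub_app, mul_app, app_neg, ← sub_eq_add_neg]

theorem linearState_succ_eq (K : Matrix (Fin d₂) (Fin d₁) ℝ) (ht : 1 ≤ t) :
    linearState A B w K' (t + 1) = app (A - B * K) (linearState A B w K' t) +
      (w t + app B (app (K - K') (linearState A B w K' t))) := by
  rw [linearState_succ ht]
  simp only [sub_app, mul_app, app_sub]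
  abel

theorem linearState_eq_sum (A : Matrix (Fin d₁) (Fin d₁) ℝ) (B : Matrix (Fin d₁) (Fin d₂) ℝ)
    (w : ℕ → Vec d₁) (K : Matrix (Fin d₂) (Fin d₁) ℝ) (n : ℕ) :
    linearState A B w K (n + 1) =
      ∑ j ∈ Finset.range n, app ((A - B * K) ^ j) (w (n - j)) :=
  state_eq_sum rfl (fun _ hs => linearState_succ (Finset.mem_Icc.1 hs).1) le_rfl

/-- The disturbance feedback parameter that imitates the linear policy `K'` on top of `K`: its
blocks are the coefficients with which `(K - K') x_t` depends on the past noise under `K'`. -/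
noncomputable def imitation (H : ℕ) (A : Matrix (Fin d₁) (Fin d₁) ℝ)
    (B : Matrix (Fin d₁) (Fin d₂) ℝ) (K K' : Matrix (Fin d₂) (Fin d₁) ℝ) : Param H d₁ d₂ :=
  WithLp.toLp 2 fun q => ((K - K') * (A - B * K') ^ (q.1 : ℕ)) q.2.1 q.2.2

theorem block_imitation {k : ℕ} (hk : k < H) :
    block (imitation H A B K K') k = (K - K') * (A - B * K') ^ k := by
  ext a b
  simp [block, imitation, hk]

theorem StronglyStable.imitation_mem_feasible (hK : StronglyStable κ γ A B K)
    (hK' : StronglyStable κ γ A B K') : imitation H A B K K' ∈ feasible H d₁ d₂ κ γ := by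
  intro k hk
  have hκ := hK.pos
  rw [block_imitation hk]
  calc _ ≤ (2 * κ) * (κ ^ 2 * (1 - γ) ^ k) := (Matrix.l2_opNorm_mul _ _).trans
        (mul_le_mul (hK.norm_sub_le hK') (hK'.norm_pow_le k) (norm_nonneg _) (by positivity))
    _ = 2 * κ ^ 3 * (1 - γ) ^ k := by ring

theorem feedforward_imitation (A : Matrix (Fin d₁) (Fin d₁) ℝ) (B : Matrix (Fin d₁) (Fin d₂) ℝ)
    (K K' : Matrix (Fin d₂) (Fin d₁) ℝ) (w : ℕ → Vec d₁) (n : ℕ) :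
    feedforward (imitation H A B K K') w (n + 1) = ∑ k ∈ Finset.range H,
      if k < n then app (K - K') (app ((A - B * K') ^ k) (w (n - k))) else 0 := by
  rw [feedforward_eq_sum_range]
  refine Finset.sum_congr rfl fun k hk => ?_
  rw [block_imitation (Finset.mem_range.1 hk), mul_app, past]
  simp only [Nat.add_lt_add_iff_right, Nat.add_sub_add_right]
  split_ifs
  · rfl
  · rw [app_zero, app_zero]

theorem IsBoundedLoop.norm_sub_feedforward_imitation_le (hL : IsBoundedLoop κ γ W A B K T w)
    (hK' : StronglyStable κ γ A B K') (ht : t ∈ Finset.Icc 1 T) :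
    ‖app (K - K') (linearState A B w K' t) - feedforward (imitation H A B K K') w t‖ ≤
      feedforwardBound κ γ W * (1 - γ) ^ H := by
  have hκ := hK'.pos
  have hW := hL.noise_nonneg
  obtain ⟨ht1, htT⟩ := Finset.mem_Icc.1 ht
  obtain ⟨n, rfl⟩ : ∃ n, t = n + 1 := ⟨t - 1, by omega⟩
  rw [linearState_eq_sum, app_sum, feedforward_imitation, feedforwardBound]
  refine norm_sum_sub_truncated_le hK'.rate_pos hK'.rate_le_one (by positivity) fun j hj => ?_
  have hpow := hK'.norm_pow_app_le j
    (hL.norm_noise_le (n - j) (Finset.mem_Icc.2 ⟨by omega, by omega⟩))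
  exact (norm_app_le_of_le (hL.stable.norm_sub_le hK') hpow).trans_eq (by ring)

@[fun_prop]
theorem continuous_app {X : Type*} [TopologicalSpace X] {n k : ℕ}
    {D : X → Matrix (Fin n) (Fin k) ℝ} {v : X → Vec k} (hD : Continuous D) (hv : Continuous v) :
    Continuous fun q => app (D q) (v q) :=
  (PiLp.continuous_toLp 2 _).comp (hD.matrix_mulVec ((PiLp.continuous_ofLp 2 _).comp hv))

theorem continuous_linearState (A : Matrix (Fin d₁) (Fin d₁) ℝ) (B : Matrix (Fin d₁) (Fin d₂) ℝ)
    (w : ℕ → Vec d₁) (t : ℕ) : Continuous fun K => linearState A B w K t := by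
  rcases Nat.eq_zero_or_pos t with rfl | ht
  · exact continuous_const
  induction t, ht using Nat.le_induction with
  | base => exact continuous_const
  | succ t ht ih =>
    simp only [linearState_succ ht]
    fun_prop

theorem continuous_linearCost (A : Matrix (Fin d₁) (Fin d₁) ℝ) (B : Matrix (Fin d₁) (Fin d₂) ℝ)
    (w : ℕ → Vec d₁) (hc : ∀ i, ∀ t ∈ Finset.Icc 1 T, Continuous (c i t)) :
    Continuous fun K => linearCost A B w c T K := by
  unfold linearCost totalCost
  refine continuous_finsetSum _ fun t ht => continuous_finsetSum _ fun i _ =>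
    (hc i t ht).comp ?_
  have hx := continuous_linearState A B w t
  exact (WithLp.prod_continuous_toLp 2 _ _).comp (hx.prodMk (continuous_app continuous_id hx).neg)

theorem stronglyStable_iff (hκ : 0 < κ) (hγ₀ : 0 < γ) (hγ₁ : γ ≤ 1) :
    StronglyStable κ γ A B K ↔ ‖K‖ ≤ κ ∧ ∃ L Q R : Matrix (Fin d₁) (Fin d₁) ℝ,
      Q * R = 1 ∧ A - B * K = Q * L * R ∧ ‖L‖ ≤ 1 - γ ∧ ‖Q‖ ≤ κ ∧ ‖R‖ ≤ κ := by
  constructor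
  · rintro ⟨-, -, -, hK, L, Q, hQ, hA, hL, hQn, hQi⟩
    exact ⟨hK, L, Q, Q⁻¹, Matrix.mul_nonsing_inv Q ((Matrix.isUnit_iff_isUnit_det Q).1 hQ), hA,
      hL, hQn, hQi⟩
  · rintro ⟨hK, L, Q, R, hQR, hA, hL, hQn, hR⟩
    obtain rfl : Q⁻¹ = R := Matrix.inv_eq_right_inv hQR
    exact ⟨hκ, hγ₀, hγ₁, hK, L, Q,
      (Matrix.isUnit_iff_isUnit_det Q).2 (Matrix.isUnit_det_of_right_inverse hQR), hA, hL, hQn, hR⟩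

theorem isCompact_setOf_stronglyStable (hκ : 0 < κ) (hγ₀ : 0 < γ) (hγ₁ : γ ≤ 1)
    (A : Matrix (Fin d₁) (Fin d₁) ℝ) (B : Matrix (Fin d₁) (Fin d₂) ℝ) :
    IsCompact {K | StronglyStable κ γ A B K} := by
  let C : Set (Matrix (Fin d₂) (Fin d₁) ℝ × Matrix (Fin d₁) (Fin d₁) ℝ ×
      Matrix (Fin d₁) (Fin d₁) ℝ × Matrix (Fin d₁) (Fin d₁) ℝ) :=
    (Metric.closedBall 0 κ ×ˢ Metric.closedBall 0 (1 - γ) ×ˢ Metric.closedBall 0 κ ×ˢ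
      Metric.closedBall 0 κ) ∩
    {q | q.2.2.1 * q.2.2.2 = 1 ∧ A - B * q.1 = q.2.2.1 * q.2.1 * q.2.2.2}
  have hC : IsCompact C := by
    refine ((isCompact_closedBall _ _).prod ((isCompact_closedBall _ _).prod
      ((isCompact_closedBall _ _).prod (isCompact_closedBall _ _)))).inter_right
        ((isClosed_eq ?_ continuous_const).and (isClosed_eq ?_ ?_))
    · exact continuous_snd.snd.fst.matrix_mul continuous_snd.snd.snd
    · exact continuous_const.sub (continuous_const.matrix_mul continuous_fst)
    · exact (continuous_snd.snd.fst.matrix_mul continuous_snd.fst).matrix_mul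
        continuous_snd.snd.snd
  have himage : {K | StronglyStable κ γ A B K} = Prod.fst '' C := by
    ext K
    refine (stronglyStable_iff hκ hγ₀ hγ₁).trans ⟨?_, ?_⟩
    · rintro ⟨hK, L, Q, R, hQR, hA, hL, hQ, hR⟩
      exact ⟨(K, L, Q, R), ⟨⟨mem_closedBall_zero_iff.2 hK, mem_closedBall_zero_iff.2 hL,
        mem_closedBall_zero_iff.2 hQ, mem_closedBall_zero_iff.2 hR⟩, hQR, hA⟩, rfl⟩
    · rintro ⟨⟨K, L, Q, R⟩, ⟨⟨hK, hL, hQ, hR⟩, hQR, hA⟩, rfl⟩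
      exact ⟨mem_closedBall_zero_iff.1 hK, L, Q, R, hQR, hA, mem_closedBall_zero_iff.1 hL,
        mem_closedBall_zero_iff.1 hQ, mem_closedBall_zero_iff.1 hR⟩
  rw [himage]
  exact hC.image continuous_fst

theorem StronglyStable.exists_isMinOn_linearCost (hK : StronglyStable κ γ A B K)
    (w : ℕ → Vec d₁) (hc : ∀ i, ∀ t ∈ Finset.Icc 1 T, Continuous (c i t)) :
    ∃ Kopt, StronglyStable κ γ A B Kopt ∧ ∀ K', StronglyStable κ γ A B K' →
      linearCost A B w c T Kopt ≤ linearCost A B w c T K' :=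
  (isCompact_setOf_stronglyStable hK.pos hK.rate_pos hK.rate_le_one A B).exists_isMinOn ⟨K, hK⟩
    (continuous_linearCost A B w hc).continuousOn

end LinearPolicies

/-! ### Surrogate costs -/

section AffineComposition

variable {E F : Type*} [NormedAddCommGroup E] [InnerProductSpace ℝ E] [FiniteDimensional ℝ E]
  [NormedAddCommGroup F] {c : F → ℝ}

theorem hasFDerivAt_comp_const_add [NormedSpace ℝ F] (hd : Differentiable ℝ c) (p : F)
    (Λ : E →ₗ[ℝ] F) (M : E) :
    HasFDerivAt (fun N => c (p + Λ N)) ((fderiv ℝ c (p + Λ M)).comp Λ.toContinuousLinearMap) M :=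
  (hd (p + Λ M)).hasFDerivAt.comp M (Λ.toContinuousLinearMap.hasFDerivAt.const_add p)

theorem sub_le_inner_gradient_comp [NormedSpace ℝ F] (hc : ConvexOn ℝ Set.univ c)
    (hd : Differentiable ℝ c) (p : F) (Λ : E →ₗ[ℝ] F) (M N : E) :
    c (p + Λ M) - c (p + Λ N) ≤ inner ℝ (gradient (fun N => c (p + Λ N)) M) (M - N) := by
  rw [← InnerProductSpace.toDual_apply_apply (𝕜 := ℝ), toDual_gradient,
    (hasFDerivAt_comp_const_add hd p Λ M).fderiv]
  refine (sub_le_fderiv_of_convexOn hc (hd _) _).trans_eq ?_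
  rw [add_sub_add_left_eq_sub, ← map_sub, ContinuousLinearMap.comp_apply,
    LinearMap.coe_toContinuousLinearMap']

theorem norm_gradient_comp_le [InnerProductSpace ℝ F] [CompleteSpace F]
    (hd : Differentiable ℝ c) (p : F) (Λ : E →ₗ[ℝ] F) {a : ℝ} (ha : 0 ≤ a)
    (hΛ : ∀ N, ‖Λ N‖ ≤ a * ‖N‖) (M : E) :
    ‖gradient (fun N => c (p + Λ N)) M‖ ≤ ‖gradient c (p + Λ M)‖ * a := by
  rw [← LinearIsometryEquiv.norm_map (InnerProductSpace.toDual ℝ E), toDual_gradient,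
    (hasFDerivAt_comp_const_add hd p Λ M).fderiv,
    ← LinearIsometryEquiv.norm_map (InnerProductSpace.toDual ℝ F), toDual_gradient]
  refine (ContinuousLinearMap.opNorm_comp_le _ _).trans ?_
  exact mul_le_mul_of_nonneg_left (ContinuousLinearMap.opNorm_le_bound _ ha hΛ) (norm_nonneg _)

end AffineComposition

section SurrogateCosts

variable {H d₁ d₂ T t : ℕ} {A : Matrix (Fin d₁) (Fin d₁) ℝ} {B : Matrix (Fin d₁) (Fin d₂) ℝ}
  {K : Matrix (Fin d₂) (Fin d₁) ℝ} {κ γ W G D : ℝ} {w : ℕ → Vec d₁} {c : Pair d₁ d₂ → ℝ}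

theorem IsCost.continuous (hc : IsCost G c) : Continuous c :=
  continuousOn_univ.1 (hc.convex.continuousOn isOpen_univ)

theorem IsCost.nonneg (hc : IsCost G c) : 0 ≤ G := by
  simpa using (norm_nonneg _).trans (hc.gradient_le 1 0 0 (by simp) (by simp))

theorem IsCost.sub_le (hc : IsCost G c) {y : Vec d₁} {v : Vec d₂} (hy : ‖y‖ ≤ D) (hv : ‖v‖ ≤ D)
    (q : Pair d₁ d₂) : c (pair y v) - c q ≤ G * D * ‖pair y v - q‖ := by
  refine (sub_le_fderiv_of_convexOn hc.convex (hc.differentiable _) q).trans ?_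
  refine (Real.le_norm_self _).trans ((ContinuousLinearMap.le_opNorm _ _).trans ?_)
  rw [← toDual_gradient, LinearIsometryEquiv.norm_map]
  exact mul_le_mul_of_nonneg_right (hc.gradient_le D y v hy hv) (norm_nonneg _)

/-- The linear part of the surrogate state. -/
noncomputable def stateLin (H : ℕ) (A : Matrix (Fin d₁) (Fin d₁) ℝ)
    (B : Matrix (Fin d₁) (Fin d₂) ℝ) (K : Matrix (Fin d₂) (Fin d₁) ℝ) (w : ℕ → Vec d₁) (t : ℕ) :
    Param H d₁ d₂ →ₗ[ℝ] Vec d₁ :=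
  ∑ j ∈ Finset.range (H + 1), Matrix.toEuclideanLin ((A - B * K) ^ j) ∘ₗ
    Matrix.toEuclideanLin B ∘ₗ feedforwardLin H d₂ w (t - 1 - j)

/-- The linear part of the surrogate state-action pair. -/
noncomputable def pairLin (H : ℕ) (A : Matrix (Fin d₁) (Fin d₁) ℝ)
    (B : Matrix (Fin d₁) (Fin d₂) ℝ) (K : Matrix (Fin d₂) (Fin d₁) ℝ) (w : ℕ → Vec d₁) (t : ℕ) :
    Param H d₁ d₂ →ₗ[ℝ] Pair d₁ d₂ :=
  (WithLp.linearEquiv 2 ℝ (Vec d₁ × Vec d₂)).symm.toLinearMap ∘ₗ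
    (stateLin H A B K w t).prod
      (-(Matrix.toEuclideanLin K ∘ₗ stateLin H A B K w t) + feedforwardLin H d₂ w t)

theorem stateLin_apply (A : Matrix (Fin d₁) (Fin d₁) ℝ) (B : Matrix (Fin d₁) (Fin d₂) ℝ)
    (K : Matrix (Fin d₂) (Fin d₁) ℝ) (w : ℕ → Vec d₁) (t : ℕ) (M : Param H d₁ d₂) :
    stateLin H A B K w t M = ∑ j ∈ Finset.range (H + 1),
      app ((A - B * K) ^ j) (app B (feedforward M w (t - 1 - j))) :=
  LinearMap.sum_apply _ _ _

theorem pairLin_apply (A : Matrix (Fin d₁) (Fin d₁) ℝ) (B : Matrix (Fin d₁) (Fin d₂) ℝ)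
    (K : Matrix (Fin d₂) (Fin d₁) ℝ) (w : ℕ → Vec d₁) (t : ℕ) (M : Param H d₁ d₂) :
    pairLin H A B K w t M = pair (stateLin H A B K w t M)
      (-app K (stateLin H A B K w t M) + feedforward M w t) :=
  rfl

theorem surrogateState_eq_add (A : Matrix (Fin d₁) (Fin d₁) ℝ) (B : Matrix (Fin d₁) (Fin d₂) ℝ)
    (K : Matrix (Fin d₂) (Fin d₁) ℝ) (w : ℕ → Vec d₁) (t : ℕ) (M : Param H d₁ d₂) :
    surrogateState A B K w t M = surrogateState A B K w t (0 : Param H d₁ d₂) +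
      stateLin H A B K w t M := by
  simp only [surrogateState_eq, stateLin_apply, feedforward_zero, app_zero, add_zero, app_add,
    Finset.sum_add_distrib]

theorem surrogatePair_eq_add (A : Matrix (Fin d₁) (Fin d₁) ℝ) (B : Matrix (Fin d₁) (Fin d₂) ℝ)
    (K : Matrix (Fin d₂) (Fin d₁) ℝ) (w : ℕ → Vec d₁) (t : ℕ) (M : Param H d₁ d₂) :
    surrogatePair A B K w t M =
      surrogatePair A B K w t (0 : Param H d₁ d₂) + pairLin H A B K w t M := by
  rw [eq_comm, ← eq_sub_iff_add_eq', eq_comm, surrogatePair, surrogatePair, pair_sub_pair,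
    pairLin_apply, surrogateAction, surrogateAction, feedforward_zero,
    surrogateState_eq_add A B K w t M, app_add, add_sub_cancel_left]
  congr 1
  abel

theorem surrogateCost_eq (A : Matrix (Fin d₁) (Fin d₁) ℝ) (B : Matrix (Fin d₁) (Fin d₂) ℝ)
    (K : Matrix (Fin d₂) (Fin d₁) ℝ) (w : ℕ → Vec d₁) (c : Pair d₁ d₂ → ℝ) (t : ℕ) :
    surrogateCost A B K w c t = fun M : Param H d₁ d₂ =>
      c (surrogatePair A B K w t (0 : Param H d₁ d₂) + pairLin H A B K w t M) := by
  funext M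
  rw [← surrogatePair_eq_add, surrogateCost, surrogatePair]

theorem IsCost.surrogateCost_sub_le (hc : IsCost G c) (A : Matrix (Fin d₁) (Fin d₁) ℝ)
    (B : Matrix (Fin d₁) (Fin d₂) ℝ) (K : Matrix (Fin d₂) (Fin d₁) ℝ) (w : ℕ → Vec d₁) (t : ℕ)
    (M N : Param H d₁ d₂) :
    surrogateCost A B K w c t M - surrogateCost A B K w c t N ≤
      inner ℝ (gradient (surrogateCost A B K w c t) M) (M - N) := by
  rw [surrogateCost_eq]
  exact sub_le_inner_gradient_comp hc.convex hc.differentiable _ _ M N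

theorem IsBoundedLoop.norm_pairLin_le (hL : IsBoundedLoop κ γ W A B K T w) (ht : t ≤ T + 1)
    (M : Param H d₁ d₂) :
    ‖pairLin H A B K w t M‖ ≤ (κ ^ 3 / γ + κ ^ 4 / γ + 1) * W * √H * ‖M‖ := by
  have hκ := hL.stable.pos
  have hγ := hL.stable.rate_pos
  have hW := hL.noise_nonneg
  set a := W * √H * ‖M‖ with ha
  have hff : ∀ s ≤ T + 1, ‖feedforward M w s‖ ≤ a := fun s hs =>
    DistControl.norm_feedforward_le hW hL.norm_noise_le hs M
  have hstate : ‖stateLin H A B K w t M‖ ≤ κ ^ 2 * (κ * a) / γ := by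
    rw [stateLin_apply]
    refine norm_sum_geometric_le hγ hL.stable.rate_le_one (by positivity) fun j _ => ?_
    exact hL.stable.norm_pow_app_le j (norm_app_le_of_le hL.norm_input_le (hff _ (by omega)))
  have haction : ‖-app K (stateLin H A B K w t M) + feedforward M w t‖ ≤
      κ * (κ ^ 2 * (κ * a) / γ) + a :=
    norm_add_le_of_le (by rw [norm_neg]; exact norm_app_le_of_le hL.stable.norm_le hstate)
      (hff t ht)
  calc _ ≤ κ ^ 2 * (κ * a) / γ + (κ * (κ ^ 2 * (κ * a) / γ) + a) := by
        rw [pairLin_apply]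
        exact (norm_pair_le _ _).trans (add_le_add hstate haction)
    _ = _ := by
        rw [ha]
        ring

/-- A bound on the gradients of the surrogate costs at feasible parameters, up to a factor `√H`. -/
noncomputable def gradientBound (κ γ W G : ℝ) : ℝ :=
  G * radius κ γ W * ((κ ^ 3 / γ + κ ^ 4 / γ + 1) * W)

theorem gradientBound_nonneg (hκ : 0 ≤ κ) (hγ : 0 ≤ γ) (hW : 0 ≤ W) (hG : 0 ≤ G) :
    0 ≤ gradientBound κ γ W G := by
  have hD := radius_nonneg hκ hγ hW
  unfold gradientBound
  positivity

theorem IsCost.norm_gradient_surrogateCost_le (hc : IsCost G c)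
    (hL : IsBoundedLoop κ γ W A B K T w) (ht : t ≤ T + 1) {M : Param H d₁ d₂}
    (hM : M ∈ feasible H d₁ d₂ κ γ) :
    ‖gradient (surrogateCost A B K w c t) M‖ ≤ gradientBound κ γ W G * √H := by
  have hb : 0 ≤ (κ ^ 3 / γ + κ ^ 4 / γ + 1) * W * √H := by
    have hκ := hL.stable.pos
    have hγ := hL.stable.rate_pos
    have hW := hL.noise_nonneg
    positivity
  obtain ⟨hy, hv⟩ := hL.norm_surrogate_le hM ht
  have hgrad : ‖gradient c (surrogatePair A B K w t M)‖ ≤ G * radius κ γ W :=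
    hc.gradient_le _ _ _ hy hv
  rw [surrogatePair_eq_add] at hgrad
  rw [surrogateCost_eq]
  refine (norm_gradient_comp_le hc.differentiable _ _ hb (hL.norm_pairLin_le ht) M).trans ?_
  exact (mul_le_mul_of_nonneg_right hgrad hb).trans_eq (by rw [gradientBound]; ring)

end SurrogateCosts

/-! ### Regret of a run -/

theorem norm_sub_le_of_norm_succ_sub_le {E : Type*} [SeminormedAddCommGroup E] {z : ℕ → E} {a : ℝ}
    {s t : ℕ} (hst : s ≤ t) (h : ∀ k ∈ Finset.Ico s t, ‖z (k + 1) - z k‖ ≤ a) :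
    ‖z s - z t‖ ≤ a * (t - s) := by
  rw [← dist_eq_norm]
  refine (dist_le_Ico_sum_of_dist_le hst (d := fun _ => a) fun {k} hsk hkt => ?_).trans_eq ?_
  · rw [dist_comm, dist_eq_norm]
    exact h k (Finset.mem_Ico.2 ⟨hsk, hkt⟩)
  · rw [Finset.sum_const, Nat.card_Ico, nsmul_eq_mul, Nat.cast_sub hst, mul_comm]

section Comparator

variable {H d₁ d₂ T t : ℕ} {A : Matrix (Fin d₁) (Fin d₁) ℝ} {B : Matrix (Fin d₁) (Fin d₂) ℝ}
  {K K' : Matrix (Fin d₂) (Fin d₁) ℝ} {κ γ W G : ℝ} {w : ℕ → Vec d₁} {c : Pair d₁ d₂ → ℝ}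

theorem IsBoundedLoop.surrogateCost_imitation_sub_le (hL : IsBoundedLoop κ γ W A B K T w)
    (hK' : StronglyStable κ γ A B K') (hc : IsCost G c) (ht : t ∈ Finset.Icc 1 T) :
    surrogateCost A B K w c t (imitation H A B K K') -
        c (pair (linearState A B w K' t) (-app K' (linearState A B w K' t))) ≤
      G * radius κ γ W * (((1 + κ) * (κ ^ 3 * (feedforwardBound κ γ W / γ) + stateBound κ γ W) +
        feedforwardBound κ γ W) * (1 - γ) ^ H) := by
  have hN : imitation H A B K K' ∈ feasible H d₁ d₂ κ γ := hL.stable.imitation_mem_feasible hK'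
  have htT : t ≤ T + 1 := (Finset.mem_Icc.1 ht).2.trans T.le_succ
  have hnear := hL.norm_pair_sub_surrogatePair_le hN (x := linearState A B w K')
    (z := fun s => app (K - K') (linearState A B w K' s)) rfl
    (fun s hs => linearState_succ_eq K (Finset.mem_Icc.1 hs).1) ht
    (mul_nonneg hL.feedforwardBound_nonneg
      (pow_nonneg (sub_nonneg.2 hL.stable.rate_le_one) H)) le_rfl fun s hs => by
        rw [zero_mul, add_zero]
        exact hL.norm_sub_feedforward_imitation_le hK'
          (Finset.Icc_subset_Icc_right (Finset.mem_Icc.1 ht).2 hs)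
  have haction : -app K (linearState A B w K' t) + app (K - K') (linearState A B w K' t) =
      -app K' (linearState A B w K' t) := by
    rw [sub_app]
    abel
  rw [haction, norm_sub_rev] at hnear
  obtain ⟨hy, hv⟩ := hL.norm_surrogate_le hN htT
  refine (hc.sub_le hy hv _).trans ((mul_le_mul_of_nonneg_left hnear
    (mul_nonneg hc.nonneg hL.radius_nonneg)).trans_eq ?_)
  ring

end Comparator

/-- The coefficient of the step size in the cost of tracking a slowly varying parameter. -/
noncomputable def trackingCoeff (m : ℕ) (κ γ W G : ℝ) : ℝ :=
  G * radius κ γ W * ((1 + κ) * (κ ^ 3 * (W * ((2 * √m + 1) * gradientBound κ γ W G)) / γ ^ 2))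

/-- The coefficient of the step size in the regret bound. Agreement between the agents contributes
`2 * √m` to the last factor, projected gradient descent contributes `2 * √m + 1 / 2`. -/
noncomputable def rateCoeff (m : ℕ) (κ γ W G : ℝ) : ℝ :=
  trackingCoeff m κ γ W G + gradientBound κ γ W G ^ 2 * (4 * √m + 1 / 2)

/-- The coefficient of the truncation error in the regret bound. -/
noncomputable def truncationCoeff (κ γ W G : ℝ) : ℝ :=
  G * radius κ γ W *
    ((1 + κ) * (κ ^ 3 * (feedforwardBound κ γ W / γ) + 2 * stateBound κ γ W) +
      feedforwardBound κ γ W)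

/-- The coefficient of the squared diameter of the feasible set in the regret bound. -/
noncomputable def diameterCoeff (d₁ d₂ : ℕ) (κ : ℝ) : ℝ := 2 * (d₂ * d₁ * (2 * κ ^ 3) ^ 2)

namespace IsRun

variable {m H d₁ d₂ T t : ℕ} {A : Matrix (Fin d₁) (Fin d₁) ℝ} {B : Matrix (Fin d₁) (Fin d₂) ℝ}
  {K K' : Matrix (Fin d₂) (Fin d₁) ℝ} {P : Matrix (Fin m) (Fin m) ℝ} {κ γ W G η : ℝ}
  {w : ℕ → Vec d₁} {c : Fin m → ℕ → Pair d₁ d₂ → ℝ} {x : Fin m → ℕ → Vec d₁}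
  {u : Fin m → ℕ → Vec d₂} {what : Fin m → ℕ → Vec d₁} {M : Fin m → ℕ → Param H d₁ d₂}

theorem recover_eq (h : IsRun κ γ η A B K P T w c x u what M) (i : Fin m)
    (ht : t ∈ Finset.Icc 1 T) : what i t = w t := by
  rw [h.recover i t ht, h.dynamics i t ht]
  abel

theorem control_eq (h : IsRun κ γ η A B K P T w c x u what M) (i : Fin m)
    (ht : t ∈ Finset.Icc 1 T) : u i t = -app K (x i t) + feedforward (M i t) w t := by
  rw [h.control i t ht, feedforward_congr (fun s => h.recover_eq i)
    ((Finset.mem_Icc.1 ht).2.trans T.le_succ)]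

theorem state_succ (h : IsRun κ γ η A B K P T w c x u what M) (i : Fin m)
    (ht : t ∈ Finset.Icc 1 T) :
    x i (t + 1) = app (A - B * K) (x i t) + (w t + app B (feedforward (M i t) w t)) := by
  rw [h.dynamics i t ht, h.control_eq i ht, sub_app, mul_app, app_add, app_neg]
  abel

theorem isDescentRun (h : IsRun κ γ η A B K P T w c x u what M) :
    IsDescentRun P (feasible H d₁ d₂ κ γ) η T M fun i t =>
      gradient (surrogateCost A B K w (c i t) t) (M i t) where
  init := h.param_init
  step i t ht := by
    have hcost : surrogateCost (H := H) A B K (what i) (c i t) t =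
        surrogateCost A B K w (c i t) t := funext fun N =>
      congrArg (c i t) (surrogatePair_congr (fun s => h.recover_eq i)
        ((Finset.mem_Icc.1 ht).2.trans T.le_succ) N)
    rw [← hcost]
    exact h.update i t ht

theorem param_mem (h : IsRun κ γ η A B K P T w c x u what M) (i : Fin m)
    (ht : t ∈ Finset.Icc 1 T) : M i t ∈ feasible H d₁ d₂ κ γ :=
  h.isDescentRun.mem i (Finset.Icc_subset_Icc_right T.le_succ ht)

theorem norm_gradient_le (h : IsRun κ γ η A B K P T w c x u what M)
    (hL : IsBoundedLoop κ γ W A B K T w) (hc : ∀ i, ∀ t ∈ Finset.Icc 1 T, IsCost G (c i t))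
    (i j : Fin m) (ht : t ∈ Finset.Icc 1 T) :
    ‖gradient (surrogateCost A B K w (c i t) t) (M j t)‖ ≤ gradientBound κ γ W G * √H :=
  (hc i t ht).norm_gradient_surrogateCost_le hL ((Finset.mem_Icc.1 ht).2.trans T.le_succ)
    (h.param_mem j ht)

theorem norm_param_sub_le (h : IsRun κ γ η A B K P T w c x u what M) (hP : IsNetwork P)
    (hη : 0 ≤ η) (hL : IsBoundedLoop κ γ W A B K T w)
    (hc : ∀ i, ∀ t ∈ Finset.Icc 1 T, IsCost G (c i t)) (i j : Fin m) (ht : t ∈ Finset.Icc 1 T) :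
    ‖M i t - M j t‖ ≤
      2 * √m * (η * (gradientBound κ γ W G * √H) / (1 - secondSingularValue P)) :=
  h.isDescentRun.norm_sub_le hP convex_feasible hη
    ((norm_nonneg _).trans (h.norm_gradient_le hL hc i i ht))
    (fun k _ => h.norm_gradient_le hL hc k k) i j (Finset.Icc_subset_Icc_right T.le_succ ht)

theorem norm_param_sub_le_of_le (h : IsRun κ γ η A B K P T w c x u what M) (hP : IsNetwork P)
    (hη : 0 ≤ η) (hL : IsBoundedLoop κ γ W A B K T w)
    (hc : ∀ i, ∀ t ∈ Finset.Icc 1 T, IsCost G (c i t)) (i : Fin m) {s : ℕ} (hs : 1 ≤ s)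
    (hst : s ≤ t) (htT : t ≤ T) :
    ‖M i s - M i t‖ ≤
      (2 * √m + 1) * (η * (gradientBound κ γ W G * √H) / (1 - secondSingularValue P)) *
        (t - s) := by
  refine norm_sub_le_of_norm_succ_sub_le (z := M i) hst fun k hk => ?_
  obtain ⟨hsk, hkt⟩ := Finset.mem_Ico.1 hk
  have hk' : k ∈ Finset.Icc 1 T := Finset.mem_Icc.2 ⟨hs.trans hsk, by omega⟩
  exact h.isDescentRun.norm_succ_sub_le hP convex_feasible hη
    ((norm_nonneg _).trans (h.norm_gradient_le hL hc i i hk'))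
    (fun j _ => h.norm_gradient_le hL hc j j) i hk'

theorem norm_le_radius (h : IsRun κ γ η A B K P T w c x u what M)
    (hL : IsBoundedLoop κ γ W A B K T w) (j : Fin m) (ht : t ∈ Finset.Icc 1 T) :
    ‖x j t‖ ≤ radius κ γ W ∧ ‖u j t‖ ≤ radius κ γ W := by
  have hstate : ‖x j t‖ ≤ stateBound κ γ W :=
    hL.norm_state_le (h.state_init j) (fun s => h.state_succ j)
      (fun s hs => hL.norm_add_app_feedforward_le (h.param_mem j hs) hs) ht
  rw [h.control_eq j ht]
  exact hL.norm_neg_app_add_le hstate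
    (hL.norm_feedforward_le (h.param_mem j ht) ((Finset.mem_Icc.1 ht).2.trans T.le_succ))

theorem norm_pair_sub_surrogatePair_le (h : IsRun κ γ η A B K P T w c x u what M)
    (hP : IsNetwork P) (hη : 0 ≤ η) (hL : IsBoundedLoop κ γ W A B K T w)
    (hc : ∀ i, ∀ t ∈ Finset.Icc 1 T, IsCost G (c i t)) (j : Fin m) (ht : t ∈ Finset.Icc 1 T) :
    ‖pair (x j t) (u j t) - surrogatePair A B K w t (M j t)‖ ≤
      (1 + κ) * (κ ^ 3 * (W * ((2 * √m + 1) * gradientBound κ γ W G)) / γ ^ 2 *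
        (η * H / (1 - secondSingularValue P)) + stateBound κ γ W * (1 - γ) ^ H) := by
  have htT := (Finset.mem_Icc.1 ht).2
  set Δ := (2 * √m + 1) * (η * (gradientBound κ γ W G * √H) / (1 - secondSingularValue P))
    with hΔ
  have hb : 0 ≤ W * √H * Δ := by
    have hW := hL.noise_nonneg
    have hg := (norm_nonneg _).trans (h.norm_gradient_le hL hc j j ht)
    have hβ := sub_pos.2 hP.secondSingularValue_lt_one
    positivity
  have hnear := hL.norm_pair_sub_surrogatePair_le (h.param_mem j ht) (h.state_init j)
    (fun s => h.state_succ j) ht le_rfl hb fun s hs => by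
      obtain ⟨hs1, hst⟩ := Finset.mem_Icc.1 hs
      rw [← feedforward_sub, zero_add, mul_assoc (W * √H)]
      refine (DistControl.norm_feedforward_le hL.noise_nonneg hL.norm_noise_le (by omega) _).trans
        (mul_le_mul_of_nonneg_left ?_ (mul_nonneg hL.noise_nonneg (Real.sqrt_nonneg _)))
      exact h.norm_param_sub_le_of_le hP hη hL hc j hs1 hst htT
  rw [← h.control_eq j ht] at hnear
  calc _ ≤ _ := hnear
    _ = (1 + κ) * (κ ^ 3 * (W * ((2 * √m + 1) * gradientBound κ γ W G)) / γ ^ 2 *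
          (η * (√H * √H) / (1 - secondSingularValue P)) + stateBound κ γ W * (1 - γ) ^ H) := by
        rw [hΔ]
        ring
    _ = _ := by rw [Real.mul_self_sqrt H.cast_nonneg]

theorem cost_sub_surrogateCost_le (h : IsRun κ γ η A B K P T w c x u what M)
    (hP : IsNetwork P) (hη : 0 ≤ η) (hL : IsBoundedLoop κ γ W A B K T w)
    (hc : ∀ i, ∀ t ∈ Finset.Icc 1 T, IsCost G (c i t)) (i j : Fin m) (ht : t ∈ Finset.Icc 1 T) :
    c i t (pair (x j t) (u j t)) - surrogateCost A B K w (c i t) t (M j t) ≤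
      trackingCoeff m κ γ W G * (η * H / (1 - secondSingularValue P)) +
        G * radius κ γ W * ((1 + κ) * stateBound κ γ W) * (1 - γ) ^ H := by
  obtain ⟨hx, hu⟩ := h.norm_le_radius hL j ht
  refine ((hc i t ht).sub_le hx hu _).trans
    ((mul_le_mul_of_nonneg_left (h.norm_pair_sub_surrogatePair_le hP hη hL hc j ht)
      (mul_nonneg (hc i t ht).nonneg hL.radius_nonneg)).trans_eq ?_)
  rw [trackingCoeff]
  ring

theorem surrogateCost_sub_surrogateCost_le (h : IsRun κ γ η A B K P T w c x u what M)
    (hP : IsNetwork P) (hη : 0 ≤ η) (hL : IsBoundedLoop κ γ W A B K T w)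
    (hc : ∀ i, ∀ t ∈ Finset.Icc 1 T, IsCost G (c i t)) (i j : Fin m) (ht : t ∈ Finset.Icc 1 T) :
    surrogateCost A B K w (c i t) t (M j t) - surrogateCost A B K w (c i t) t (M i t) ≤
      gradientBound κ γ W G ^ 2 * (2 * √m) * (η * H / (1 - secondSingularValue P)) := by
  have hgrad := h.norm_gradient_le hL hc i j ht
  calc _ ≤ inner ℝ (gradient (surrogateCost A B K w (c i t) t) (M j t)) (M j t - M i t) :=
        (hc i t ht).surrogateCost_sub_le _ _ _ _ _ _ _
    _ ≤ gradientBound κ γ W G * √H *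
          (2 * √m * (η * (gradientBound κ γ W G * √H) / (1 - secondSingularValue P))) :=
        (real_inner_le_norm _ _).trans (mul_le_mul hgrad
          (h.norm_param_sub_le hP hη hL hc j i ht) (norm_nonneg _)
          ((norm_nonneg _).trans hgrad))
    _ = gradientBound κ γ W G ^ 2 * (2 * √m) *
          (η * (√H * √H) / (1 - secondSingularValue P)) := by
        ring
    _ = _ := by rw [Real.mul_self_sqrt H.cast_nonneg]

theorem sum_sum_surrogateCost_sub_le (h : IsRun κ γ η A B K P T w c x u what M)
    (hP : IsNetwork P) (hη : 0 < η) (hL : IsBoundedLoop κ γ W A B K T w)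
    (hc : ∀ i, ∀ t ∈ Finset.Icc 1 T, IsCost G (c i t)) (hG : 0 ≤ G) {N : Param H d₁ d₂}
    (hN : N ∈ feasible H d₁ d₂ κ γ) :
    ∑ t ∈ Finset.Icc 1 T, ∑ i, (surrogateCost A B K w (c i t) t (M i t) -
        surrogateCost A B K w (c i t) t N) ≤
      m * (diameterCoeff d₁ d₂ κ * (H / η)) + T * (m * (gradientBound κ γ W G ^ 2 *
        (2 * √m + 1 / 2) * (η * H / (1 - secondSingularValue P)))) := by
  have hκ := hL.stable.pos.le
  have hγ := hL.stable.rate_pos.le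
  have hg := gradientBound_nonneg hκ hγ hL.noise_nonneg hG
  have hdiam : (∑ i, ‖M i 1 - N‖ ^ 2) / (2 * η) ≤ m * (diameterCoeff d₁ d₂ κ * (H / η)) := by
    have hi : ∀ i ∈ Finset.univ, ‖M i 1 - N‖ ^ 2 ≤ 4 * (H * (d₂ * d₁ * (2 * κ ^ 3) ^ 2)) :=
      fun i _ => norm_sub_sq_le_of_mem_feasible hκ hγ hL.stable.rate_le_one
        (h.isDescentRun.mem i (Finset.mem_Icc.2 ⟨le_rfl, by omega⟩)) hN
    have hsum := Finset.sum_le_card_nsmul _ _ _ hi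
    rw [Finset.card_univ, Fintype.card_fin, nsmul_eq_mul] at hsum
    refine (div_le_div_of_nonneg_right hsum (by positivity)).trans_eq ?_
    rw [diameterCoeff]
    field
  calc _ ≤ ∑ t ∈ Finset.Icc 1 T, ∑ i,
          inner ℝ (gradient (surrogateCost A B K w (c i t) t) (M i t)) (M i t - N) :=
        Finset.sum_le_sum fun t ht => Finset.sum_le_sum fun i _ =>
          (hc i t ht).surrogateCost_sub_le _ _ _ _ _ _ _
    _ ≤ _ := h.isDescentRun.sum_sum_inner_sub_le hP convex_feasible hη (by positivity)
        (fun i _ => h.norm_gradient_le hL hc i i) hN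
    _ ≤ m * (diameterCoeff d₁ d₂ κ * (H / η)) + T * (m * (gradientBound κ γ W G ^ 2 *
          (2 * √m + 1 / 2) * (η * (√H * √H) / (1 - secondSingularValue P)))) :=
        add_le_add hdiam (le_of_eq (by ring))
    _ = _ := by rw [Real.mul_self_sqrt H.cast_nonneg]

theorem cost_sub_cost_le (h : IsRun κ γ η A B K P T w c x u what M) (hP : IsNetwork P)
    (hη : 0 ≤ η) (hL : IsBoundedLoop κ γ W A B K T w)
    (hc : ∀ i, ∀ t ∈ Finset.Icc 1 T, IsCost G (c i t)) (hK' : StronglyStable κ γ A B K')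
    (i j : Fin m) (ht : t ∈ Finset.Icc 1 T) :
    c i t (pair (x j t) (u j t)) -
        c i t (pair (linearState A B w K' t) (-app K' (linearState A B w K' t))) ≤
      surrogateCost A B K w (c i t) t (M i t) -
        surrogateCost A B K w (c i t) t (imitation H A B K K') +
      ((trackingCoeff m κ γ W G + gradientBound κ γ W G ^ 2 * (2 * √m)) *
        (η * H / (1 - secondSingularValue P)) + truncationCoeff κ γ W G * (1 - γ) ^ H) := by
  have htrack := h.cost_sub_surrogateCost_le hP hη hL hc i j ht
  have hexchange := h.surrogateCost_sub_surrogateCost_le hP hη hL hc i j ht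
  have hcomparator := hL.surrogateCost_imitation_sub_le (H := H) hK' (hc i t ht) ht
  rw [truncationCoeff]
  linarith

theorem regret_le (h : IsRun κ γ η A B K P T w c x u what M) (hP : IsNetwork P) (hη : 0 < η)
    (hL : IsBoundedLoop κ γ W A B K T w) (hc : ∀ i, ∀ t ∈ Finset.Icc 1 T, IsCost G (c i t))
    (hG : 0 ≤ G) (hK' : StronglyStable κ γ A B K') (j : Fin m) :
    totalCost c T (x j) (u j) - linearCost A B w c T K' ≤
      m * (rateCoeff m κ γ W G * (T * (η * H)) / (1 - secondSingularValue P) +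
        truncationCoeff κ γ W G * (T * (1 - γ) ^ H) + diameterCoeff d₁ d₂ κ * (H / η)) := by
  have hlearn := h.sum_sum_surrogateCost_sub_le hP hη hL hc hG
    (hL.stable.imitation_mem_feasible hK')
  have hrounds := Finset.sum_le_sum fun t ht => Finset.sum_le_sum fun i (_ : i ∈ Finset.univ) =>
    h.cost_sub_cost_le hP hη.le hL hc hK' i j (t := t) ht
  simp only [Finset.sum_add_distrib, Finset.sum_const, Finset.card_univ, Fintype.card_fin,
    Nat.card_Icc, Nat.add_sub_cancel, nsmul_eq_mul] at hrounds
  calc _ = ∑ t ∈ Finset.Icc 1 T, ∑ i, (c i t (pair (x j t) (u j t)) -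
          c i t (pair (linearState A B w K' t) (-app K' (linearState A B w K' t)))) := by
        simp only [linearCost, totalCost, Finset.sum_sub_distrib]
    _ ≤ _ := hrounds.trans (add_le_add_left hlearn _)
    _ = _ := by
        rw [rateCoeff]
        ring

end IsRun

/-! ### Choice of the parameters -/

section Parameters

variable {κ γ W G : ℝ} {T H : ℕ}

theorem rateCoeff_nonneg (m : ℕ) (hκ : 0 ≤ κ) (hγ : 0 ≤ γ) (hW : 0 ≤ W) (hG : 0 ≤ G) :
    0 ≤ rateCoeff m κ γ W G := by
  have hD := radius_nonneg hκ hγ hW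
  have hg := gradientBound_nonneg hκ hγ hW hG
  unfold rateCoeff trackingCoeff
  positivity

theorem truncationCoeff_nonneg (hκ : 0 ≤ κ) (hγ : 0 ≤ γ) (hW : 0 ≤ W) (hG : 0 ≤ G) :
    0 ≤ truncationCoeff κ γ W G := by
  have hZ := feedforwardBound_nonneg hκ hγ hW
  have hX := stateBound_nonneg hκ hγ hW
  have hD := radius_nonneg hκ hγ hW
  unfold truncationCoeff
  positivity

theorem diameterCoeff_nonneg (d₁ d₂ : ℕ) (κ : ℝ) : 0 ≤ diameterCoeff d₁ d₂ κ := by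
  unfold diameterCoeff
  positivity

theorem mul_one_sub_pow_le_one (hγ₀ : 0 < γ) (hγ₁ : γ ≤ 1) (hT : 0 < T)
    (hH : 1 / γ * Real.log T ≤ H) : T * (1 - γ) ^ H ≤ 1 := by
  have hT' : (0 : ℝ) < T := Nat.cast_pos.2 hT
  have hlog : Real.log T ≤ H * γ := by rwa [one_div_mul_eq_div, div_le_iff₀ hγ₀] at hH
  calc (T : ℝ) * (1 - γ) ^ H ≤ T * Real.exp (-γ) ^ H :=
        mul_le_mul_of_nonneg_left
          (pow_le_pow_left₀ (sub_nonneg.2 hγ₁) (Real.one_sub_le_exp_neg γ) H) hT'.le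
    _ = T * Real.exp (-(H * γ)) := by rw [← Real.exp_nat_mul, mul_neg]
    _ ≤ T * Real.exp (-Real.log T) := by gcongr
    _ = 1 := by rw [Real.exp_neg, Real.exp_log hT', mul_inv_cancel₀ hT'.ne']

theorem one_le_two_mul_sqrt_mul_log (hT : 2 ≤ T) : 1 ≤ 2 * (√T * Real.log T) := by
  have hT' : (2 : ℝ) ≤ T := by exact_mod_cast hT
  have hsqrt : 1 ≤ √(T : ℝ) := Real.one_le_sqrt.2 (by linarith)
  have hlog : 1 / 2 ≤ Real.log T := by
    linarith [Real.log_le_log two_pos hT', Real.log_two_gt_d9]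
  nlinarith

variable {η η₁ η₂ h₂ : ℝ}

theorem mul_mul_le_of_le_div_sqrt (hη : 0 ≤ η) (hη₂ : η ≤ η₂ / √T) (hH : H ≤ h₂ * Real.log T) :
    T * (η * H) ≤ η₂ * h₂ * (√T * Real.log T) :=
  calc T * (η * H) ≤ T * (η₂ / √T * (h₂ * Real.log T)) :=
        mul_le_mul_of_nonneg_left (mul_le_mul hη₂ hH H.cast_nonneg (hη.trans hη₂)) T.cast_nonneg
    _ = η₂ * h₂ * (T / √T * Real.log T) := by ring
    _ = _ := by rw [Real.div_sqrt]

theorem div_le_of_div_sqrt_le (hT : 0 < T) (hη₁ : 0 < η₁) (hη : η₁ / √T ≤ η)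
    (hH : H ≤ h₂ * Real.log T) : H / η ≤ h₂ / η₁ * (√T * Real.log T) := by
  have : 0 < √(T : ℝ) := Real.sqrt_pos.2 (Nat.cast_pos.2 hT)
  calc H / η ≤ h₂ * Real.log T / (η₁ / √T) :=
        div_le_div₀ (H.cast_nonneg.trans hH) hH (by positivity) hη
    _ = _ := by field

end Parameters

/-- The constant of the regret bound for step sizes at most `η₂ / √T` and at least `η₁ / √T`, and
memory at most `h₂ * log T`. The middle `2` comes from `1 ≤ 2 * (√T * log T)`. -/
noncomputable def regretCoeff (m d₁ d₂ : ℕ) (κ γ W G η₁ η₂ h₂ : ℝ) : ℝ :=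
  m * (rateCoeff m κ γ W G * (η₂ * h₂) + truncationCoeff κ γ W G * 2 +
    diameterCoeff d₁ d₂ κ * (h₂ / η₁))

theorem IsRun.regret_le_regretCoeff_mul {m H d₁ d₂ T : ℕ} {A : Matrix (Fin d₁) (Fin d₁) ℝ}
    {B : Matrix (Fin d₁) (Fin d₂) ℝ} {K K' : Matrix (Fin d₂) (Fin d₁) ℝ}
    {P : Matrix (Fin m) (Fin m) ℝ} {κ γ W G η η₁ η₂ h₂ : ℝ} {w : ℕ → Vec d₁}
    {c : Fin m → ℕ → Pair d₁ d₂ → ℝ} {x : Fin m → ℕ → Vec d₁} {u : Fin m → ℕ → Vec d₂}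
    {what : Fin m → ℕ → Vec d₁} {M : Fin m → ℕ → Param H d₁ d₂}
    (h : IsRun κ γ η A B K P T w c x u what M) (hP : IsNetwork P)
    (hL : IsBoundedLoop κ γ W A B K T w) (hc : ∀ i, ∀ t ∈ Finset.Icc 1 T, IsCost G (c i t))
    (hT : 2 ≤ T) (hη₁ : 0 < η₁) (hηl : η₁ / √T ≤ η) (hηu : η ≤ η₂ / √T)
    (hHl : 1 / γ * Real.log T ≤ H) (hHu : H ≤ h₂ * Real.log T)
    (hK' : StronglyStable κ γ A B K') (j : Fin m) :
    totalCost c T (x j) (u j) - linearCost A B w c T K' ≤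
      regretCoeff m d₁ d₂ κ γ W G η₁ η₂ h₂ *
        (√T * Real.log T / (1 - secondSingularValue P)) := by
  have hκ := hL.stable.pos.le
  have hγ := hL.stable.rate_pos
  have hW := hL.noise_nonneg
  have hG : 0 ≤ G := (hc j 1 (Finset.mem_Icc.2 ⟨le_rfl, by omega⟩)).nonneg
  have hη : 0 < η :=
    (div_pos hη₁ (Real.sqrt_pos.2 (Nat.cast_pos.2 (by omega)))).trans_le hηl
  have hβ : 0 < 1 - secondSingularValue P := sub_pos.2 hP.secondSingularValue_lt_one
  have hrate := mul_mul_le_of_le_div_sqrt hη.le hηu hHu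
  have htruncation : T * (1 - γ) ^ H ≤ 2 * (√T * Real.log T) :=
    (mul_one_sub_pow_le_one hγ hL.stable.rate_le_one (by omega) hHl).trans
      (one_le_two_mul_sqrt_mul_log hT)
  have hdiameter := div_le_of_div_sqrt_le (by omega) hη₁ hηl hHu
  have hspread : ∀ {a : ℝ}, 0 ≤ a → a ≤ a / (1 - secondSingularValue P) :=
    hP.le_div_one_sub
  set S := √T * Real.log T
  calc _ ≤ _ := h.regret_le hP hη hL hc hG hK' j
    _ ≤ m * (rateCoeff m κ γ W G * (η₂ * h₂ * S) / (1 - secondSingularValue P) +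
          truncationCoeff κ γ W G * (2 * S / (1 - secondSingularValue P)) +
          diameterCoeff d₁ d₂ κ * (h₂ / η₁ * S / (1 - secondSingularValue P))) := by
        have h1 := rateCoeff_nonneg m hκ hγ.le hW hG
        have h2 := truncationCoeff_nonneg hκ hγ.le hW hG
        have h3 := diameterCoeff_nonneg d₁ d₂ κ
        have hS : 0 ≤ S := mul_nonneg (Real.sqrt_nonneg _) (Real.log_natCast_nonneg T)
        refine mul_le_mul_of_nonneg_left (add_le_add (add_le_add ?_ ?_) ?_) m.cast_nonneg
        · exact div_le_div_of_nonneg_right (mul_le_mul_of_nonneg_left hrate h1) hβ.le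
        · exact mul_le_mul_of_nonneg_left
            (htruncation.trans (hspread (mul_nonneg two_pos.le hS))) h2
        · exact mul_le_mul_of_nonneg_left
            (hdiameter.trans (hspread ((div_nonneg H.cast_nonneg hη.le).trans hdiameter))) h3
    _ = _ := by
        rw [regretCoeff]
        ring

end DistControl

open DistControl in
theorem theorem1_general (γ : ℝ) (m d₁ d₂ : ℕ) (κ W Gc η₁ η₂ h₁ h₂ : ℝ) (hη₁ : 0 < η₁)
    (hh₁ : 1 / γ ≤ h₁) :
    ∃ C : ℝ, 0 < C ∧
    ∀ (A : Matrix (Fin d₁) (Fin d₁) ℝ) (B : Matrix (Fin d₁) (Fin d₂) ℝ)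
      (K : Matrix (Fin d₂) (Fin d₁) ℝ) (P : Matrix (Fin m) (Fin m) ℝ)
      (w : ℕ → Vec d₁) (c : Fin m → ℕ → Pair d₁ d₂ → ℝ) (T H : ℕ) (η : ℝ)
      (x : Fin m → ℕ → Vec d₁) (u : Fin m → ℕ → Vec d₂) (what : Fin m → ℕ → Vec d₁)
      (M : Fin m → ℕ → Param H d₁ d₂),
      IsNetwork P → ‖B‖ ≤ κ → (∀ t ∈ Finset.Icc 1 T, ‖w t‖ ≤ W) →
      (∀ i, ∀ t ∈ Finset.Icc 1 T, IsCost Gc (c i t)) →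
      StronglyStable κ γ A B K → 2 ≤ T →
      η₁ / √(T : ℝ) ≤ η → η ≤ η₂ / √(T : ℝ) →
      h₁ * Real.log T ≤ H → (H : ℝ) ≤ h₂ * Real.log T →
      IsRun κ γ η A B K P T w c x u what M →
      secondSingularValue P < 1 ∧
      ∀ j : Fin m, ∃ Kopt : Matrix (Fin d₂) (Fin d₁) ℝ,
        StronglyStable κ γ A B Kopt ∧
        (∀ K' : Matrix (Fin d₂) (Fin d₁) ℝ, StronglyStable κ γ A B K' →
          linearCost A B w c T Kopt ≤ linearCost A B w c T K') ∧
        totalCost c T (x j) (u j) - linearCost A B w c T Kopt ≤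
          C * (√(T : ℝ) * Real.log T) / (1 - secondSingularValue P) := by
  refine ⟨max (regretCoeff m d₁ d₂ κ γ W Gc η₁ η₂ h₂) 1, lt_max_of_lt_right one_pos, ?_⟩
  intro A B K P w c T H η x u what M hP hB hw hc hK hT hηl hηu hHl hHu hrun
  have hβ := hP.secondSingularValue_lt_one
  have hW : 0 ≤ W := (norm_nonneg _).trans (hw 1 (Finset.mem_Icc.2 ⟨le_rfl, by omega⟩))
  have hlog : 0 ≤ Real.log T := Real.log_natCast_nonneg T
  obtain ⟨Kopt, hopt, hmin⟩ :=
    hK.exists_isMinOn_linearCost w fun i t ht => (hc i t ht).continuous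
  have hmemory := (mul_le_mul_of_nonneg_right hh₁ hlog).trans hHl
  have hscale : 0 ≤ √(T : ℝ) * Real.log T / (1 - secondSingularValue P) :=
    div_nonneg (by positivity) (sub_nonneg.2 hβ.le)
  refine ⟨hβ, fun j => ⟨Kopt, hopt, hmin, ?_⟩⟩
  rw [mul_div_assoc]
  exact (hrun.regret_le_regretCoeff_mul hP ⟨hK, hB, hW, hw⟩ hc hT hη₁ hηl hηu hmemory hHu hopt
    j).trans (mul_le_mul_of_nonneg_right (le_max_left _ _) hscale)

open DistControl in
theorem theorem1 (γ : ℝ) (hγ₀ : 0 < γ) (hγ₁ : γ ≤ 1) :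
    ∃ h₀ : ℝ, 0 < h₀ ∧
    ∀ (m d₁ d₂ : ℕ) (κ W Gc η₁ η₂ h₁ h₂ : ℝ),
      0 < η₁ → η₁ ≤ η₂ → h₀ ≤ h₁ → h₁ ≤ h₂ →
    ∃ C : ℝ, 0 < C ∧
    ∀ (A : Matrix (Fin d₁) (Fin d₁) ℝ) (B : Matrix (Fin d₁) (Fin d₂) ℝ)
      (K : Matrix (Fin d₂) (Fin d₁) ℝ) (P : Matrix (Fin m) (Fin m) ℝ)
      (w : ℕ → Vec d₁) (c : Fin m → ℕ → Pair d₁ d₂ → ℝ) (T H : ℕ) (η : ℝ)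
      (x : Fin m → ℕ → Vec d₁) (u : Fin m → ℕ → Vec d₂) (what : Fin m → ℕ → Vec d₁)
      (M : Fin m → ℕ → Param H d₁ d₂),
      IsNetwork P →
      ‖A‖ ≤ κ → ‖B‖ ≤ κ → (∀ t ∈ Finset.Icc 1 T, ‖w t‖ ≤ W) →
      (∀ i, ∀ t ∈ Finset.Icc 1 T, IsCost Gc (c i t)) →
      StronglyStable κ γ A B K →
      2 ≤ T → 1 ≤ H →
      η₁ / √(T : ℝ) ≤ η → η ≤ η₂ / √(T : ℝ) →
      h₁ * Real.log T ≤ H → (H : ℝ) ≤ h₂ * Real.log T →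
      IsRun κ γ η A B K P T w c x u what M →
      secondSingularValue P < 1 ∧
      ∀ j : Fin m, ∃ Kopt : Matrix (Fin d₂) (Fin d₁) ℝ,
        StronglyStable κ γ A B Kopt ∧
        (∀ K' : Matrix (Fin d₂) (Fin d₁) ℝ, StronglyStable κ γ A B K' →
          linearCost A B w c T Kopt ≤ linearCost A B w c T K') ∧
        totalCost c T (x j) (u j) - linearCost A B w c T Kopt ≤
          C * (√(T : ℝ) * Real.log T) / (1 - secondSingularValue P) ^ 2 := by
  refine ⟨1 / γ, by positivity, ?_⟩
  intro m d₁ d₂ κ W Gc η₁ η₂ h₁ h₂ hη₁ _ hh₁ _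
  obtain ⟨C, hC, hgeneral⟩ := theorem1_general γ m d₁ d₂ κ W Gc η₁ η₂ h₁ h₂ hη₁ hh₁
  refine ⟨C, hC, ?_⟩
  intro A B K P w c T H η x u what M hP _ hB hw hc hK hT _ hηl hηu hHl hHu hrun
  obtain ⟨hβ, hregret⟩ :=
    hgeneral A B K P w c T H η x u what M hP hB hw hc hK hT hηl hηu hHl hHu hrun
  refine ⟨hβ, fun j => (hregret j).imp fun Kopt hopt => ⟨hopt.1, hopt.2.1, hopt.2.2.trans ?_⟩⟩
  rw [pow_two, ← div_div]
  exact hP.le_div_one_sub (div_nonneg (by positivity) (sub_nonneg.2 hβ.le))
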